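/- All manifolds and fields are smooth; spacetime metrics have signature $(+,-,-,-)$, and curvature is normalised by $(\nabla_a\nabla_b-\nabla_b\nabla_a)v^c=R^c{}_{dab}v^d$, $R_{db}=R^c{}_{dcb}$. Let $(\tilde{\mathcal M},\tilde g)$ be a 4-dimensional spacetime satisfying the vacuum Einstein equation $\tilde R_{ab}=0$. Suppose that it is asymptotically Minkowskian at spatial infinity (AMSI), that is: there are a 4-manifold $\mathcal M$ with boundary $\mathcal H$, a smooth function $\Omega$ on $\mathcal M$, and a diffeomorphism of $\tilde{\mathcal M}$ onto $\mathcal M\setminus\mathcal H$ (by which the two are identified), such that $\Omega$ does not vanish on $\tilde{\mathcal M}$ and (i) $\Omega=0$ and $\mathbf d\Omega\neq 0$ on $\mathcal H$; (ii) the fields $$q=\Omega^2\big(\tilde g+\Omega^{-4}\,\mathbf d\Omega\otimes\mathbf d\Omega\big),\qquad N=\Omega^{-4}\,\tilde g^{\sharp}(\mathbf d\Omega,\cdot)$$ on $\tilde{\mathcal M}$ extend smoothly to $\mathcal M$, and the pullback of $q$ to $\mathcal H$, again denoted $q$, has signature $(+,-,-)$; (iii) $\mathcal H$ is homeomorphic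 to $\mathbb R\times\mathbb S^2$, and $(\mathcal H,q)$ is geodesically complete. Let $F=N^a\nabla_a\Omega$. Then $F$ is constant on $\mathcal H$, and the Ricci tensor $r_{ij}$ of the 3-dimensional metric $q_{ij}$ on $\mathcal H$ satisfies $$r_{ij}=2F\,q_{ij}\qquad\text{on }\mathcal H .$$ In particular $(\mathcal H,q)$ is an Einstein space. -/

import Mathlib

open Set Manifold ContDiff Topology TopologicalSpace

noncomputable section

namespace SpatialInfinity

/-! ### Tensor fields of type (0,2) on a manifold (possibly with boundary) -/

section Tensors

variable {E : Type*} [NormedAddCommGroup E] [NormedSpace ℝ E]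
  {K : Type*} [TopologicalSpace K] (I : ModelWithCorners ℝ E K)
  (M : Type*) [TopologicalSpace M] [ChartedSpace K M]

/-- A (not necessarily continuous) field of bilinear forms on the tangent spaces of `M`. -/
abbrev BilinField : Type _ :=
  ∀ x : M, TangentSpace I x →L[ℝ] TangentSpace I x →L[ℝ] ℝ

variable {M}

/-- Smoothness of a field of bilinear forms, as a section of the bundle `T*M ⊗ T*M`; at boundary
points this is smoothness up to the boundary. -/
def IsSmoothBilinField [IsManifold I ∞ M] (b : BilinField I M) : Prop :=
  ContMDiff I (I.prod 𝓘(ℝ, E →L[ℝ] E →L[ℝ] ℝ)) ∞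
    (fun x : M ↦ Bundle.TotalSpace.mk' (E →L[ℝ] E →L[ℝ] ℝ)
      (E := fun x : M ↦ TangentSpace I x →L[ℝ] TangentSpace I x →L[ℝ] ℝ) x (b x))

/-- Smoothness of a vector field. -/
def IsSmoothVectorField [IsManifold I ∞ M] (N : ∀ x : M, TangentSpace I x) : Prop :=
  ContMDiff I I.tangent ∞ (fun x : M ↦ (⟨x, N x⟩ : TangentBundle I M))

/-- The differential `dΩ` of a real function at a point, as a covector. -/
def differential (Ω : M → ℝ) (x : M) : TangentSpace I x →L[ℝ] ℝ :=
  mfderiv I 𝓘(ℝ, ℝ) Ω x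

variable {E' : Type*} [NormedAddCommGroup E'] [NormedSpace ℝ E']
  {K' : Type*} [TopologicalSpace K'] (I' : ModelWithCorners ℝ E' K')
  {M' : Type*} [TopologicalSpace M'] [ChartedSpace K' M']

/-- The pullback `f^* b` of a field of bilinear forms, `(f^* b)(u, v) = b(df u, df v)`. -/
def pullback (f : M' → M) (b : BilinField I M) : BilinField I' M' :=
  fun x ↦ (ContinuousLinearMap.precomp ℝ (mfderiv I' I f x)).comp
    ((b (f x)).comp (mfderiv I' I f x))

theorem pullback_apply (f : M' → M) (b : BilinField I M) (x : M') (u v : TangentSpace I' x) :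
    pullback I I' f b x u v = b (f x) (mfderiv I' I f x u) (mfderiv I' I f x v) :=
  rfl

end Tensors

/-- `b` is a scalar product of signature `(+,-,…,-)` on an `n`-dimensional space: it has an
orthonormal basis with one vector of square `1` and all others of square `-1`. -/
def IsLorentzian (n : ℕ) {V : Type*} [AddCommGroup V] [Module ℝ V] [TopologicalSpace V]
    (b : V →L[ℝ] V →L[ℝ] ℝ) : Prop :=
  ∃ e : Module.Basis (Fin n) ℝ V, ∀ i j,
    b (e i) (e j) = if i = j then (if (i : ℕ) = 0 then 1 else -1) else 0

/-! ### Curvature in local coordinates -/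

section Coordinates

variable {n : ℕ}

/-- The partial derivative `∂_k f` at the point `y` of `ℝⁿ`. -/
def partialDeriv (k : Fin n) (f : EuclideanSpace ℝ (Fin n) → ℝ) (y : EuclideanSpace ℝ (Fin n)) :
    ℝ :=
  fderiv ℝ f y (EuclideanSpace.single k 1)

/-- The Christoffel symbols `Γ^k_{ij}` of the metric with components `G` on (a part of) `ℝⁿ`. -/
def christoffel (G : EuclideanSpace ℝ (Fin n) → Matrix (Fin n) (Fin n) ℝ) (k i j : Fin n)
    (y : EuclideanSpace ℝ (Fin n)) : ℝ :=
  (1 / 2) * ∑ l, (G y)⁻¹ k l *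
    (partialDeriv i (fun z ↦ G z j l) y + partialDeriv j (fun z ↦ G z i l) y
      - partialDeriv l (fun z ↦ G z i j) y)

/-- The Riemann tensor `R^c_{dab}`, with the convention
`(∇_a ∇_b - ∇_b ∇_a) v^c = R^c_{dab} v^d`. -/
def riemann (G : EuclideanSpace ℝ (Fin n) → Matrix (Fin n) (Fin n) ℝ) (c d a b : Fin n)
    (y : EuclideanSpace ℝ (Fin n)) : ℝ :=
  partialDeriv a (christoffel G c b d) y - partialDeriv b (christoffel G c a d) y
    + ∑ m, (christoffel G c a m y * christoffel G m b d y
      - christoffel G c b m y * christoffel G m a d y)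

/-- The Ricci tensor `R_{db} = R^c_{dcb}`. -/
def ricci (G : EuclideanSpace ℝ (Fin n) → Matrix (Fin n) (Fin n) ℝ) (d b : Fin n)
    (y : EuclideanSpace ℝ (Fin n)) : ℝ :=
  ∑ c, riemann G c d c b y

variable {M : Type*} [TopologicalSpace M] [ChartedSpace (EuclideanSpace ℝ (Fin n)) M]

/-- The components `g_{ij} = g(∂_i, ∂_j)` of `g` in the chart `e`, as functions of the coordinates;
meaningful on `e.target`. -/
def components (g : BilinField (𝓡 n) M) (e : OpenPartialHomeomorph M (EuclideanSpace ℝ (Fin n)))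
    (y : EuclideanSpace ℝ (Fin n)) : Matrix (Fin n) (Fin n) ℝ :=
  Matrix.of fun i j ↦ g (e.symm y)
    (mfderiv (𝓡 n) (𝓡 n) e.symm y (EuclideanSpace.single i 1))
    (mfderiv (𝓡 n) (𝓡 n) e.symm y (EuclideanSpace.single j 1))

/-- The metric `g` satisfies the tensor equation `Ric(g) = lam · g`, for a function `lam` on `M`:
the components of the two sides agree in every smooth chart. -/
def RicciEq (g : BilinField (𝓡 n) M) (lam : M → ℝ) : Prop :=
  ∀ e ∈ IsManifold.maximalAtlas (𝓡 n) ∞ M, ∀ y ∈ e.target, ∀ i j,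
    ricci (components g e) i j y = lam (e.symm y) * components g e y i j

/-- The metric `g` is Einstein: `Ric(g) = c · g` for a constant `c`. -/
def IsEinstein (g : BilinField (𝓡 n) M) : Prop := ∃ c : ℝ, RicciEq g (fun _ ↦ c)

/-- `γ : ℝ → M` is an affinely parametrised geodesic of `g`: in every smooth chart
`γ̈^k + Γ^k_{ij} γ̇^i γ̇^j = 0`. -/
def IsGeodesic (g : BilinField (𝓡 n) M) (γ : ℝ → M) : Prop :=
  ContMDiff 𝓘(ℝ, ℝ) (𝓡 n) ∞ γ ∧
    ∀ e ∈ IsManifold.maximalAtlas (𝓡 n) ∞ M, ∀ t : ℝ, γ t ∈ e.source → ∀ k : Fin n,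
      iteratedDeriv 2 (fun s ↦ e (γ s) k) t
        + ∑ i, ∑ j, christoffel (components g e) k i j (e (γ t))
          * deriv (fun s ↦ e (γ s) i) t * deriv (fun s ↦ e (γ s) j) t = 0

/-- Geodesic completeness: every tangent vector is the initial velocity of a geodesic that is
defined on all of `ℝ`. -/
def IsGeodesicallyComplete (g : BilinField (𝓡 n) M) : Prop :=
  ∀ v : TangentBundle (𝓡 n) M, ∃ γ : ℝ → M, IsGeodesic g γ ∧
    (⟨γ 0, mfderiv 𝓘(ℝ, ℝ) (𝓡 n) γ 0 (1 : ℝ)⟩ : TangentBundle (𝓡 n) M) = v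

end Coordinates

/-! ### Asymptotes at spatial infinity -/

/-- `(X, g)` is a vacuum spacetime: `g` is a smooth metric of signature `(+,-,-,-)` on the
4-manifold `X` with vanishing Ricci tensor. -/
structure IsVacuumSpacetime {X : Type*} [TopologicalSpace X]
    [ChartedSpace (EuclideanSpace ℝ (Fin 4)) X] [IsManifold (𝓡 4) ∞ X]
    (g : BilinField (𝓡 4) X) : Prop where
  smooth : IsSmoothBilinField (𝓡 4) g
  lorentzian : ∀ x, IsLorentzian 4 (g x)
  ricci_eq_zero : RicciEq g (fun _ ↦ 0)

/-- The open submanifold `M ∖ ∂M` of a 4-manifold with boundary. -/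
def interiorOpens (M : Type*) [TopologicalSpace M] [ChartedSpace (EuclideanHalfSpace 4) M]
    [IsManifold (𝓡∂ 4) ∞ M] : Opens M :=
  ⟨(𝓡∂ 4).interior M, (𝓡∂ 4).isOpen_interior (n := ∞) (by simp)⟩

/-- The vacuum spacetime `(X, g)` possesses the asymptote at spatial infinity `(H, q)`. Here `M` is
a 4-manifold with boundary; the 3-manifold `H` is the boundary of `M`, through the inclusion `ι`;
`Φ` is the diffeomorphism that identifies `X` with `M ∖ H`; `q` and `N` are the smooth fields on `M`
that extend `Ω² (g + Ω⁻⁴ dΩ ⊗ dΩ)` and `Ω⁻⁴ g^♯(dΩ, ·)` to `H`. -/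
structure IsAsymptote {X M H : Type*}
    [TopologicalSpace X] [ChartedSpace (EuclideanSpace ℝ (Fin 4)) X] [IsManifold (𝓡 4) ∞ X]
    [TopologicalSpace M] [ChartedSpace (EuclideanHalfSpace 4) M] [IsManifold (𝓡∂ 4) ∞ M]
    [TopologicalSpace H] [ChartedSpace (EuclideanSpace ℝ (Fin 3)) H] [IsManifold (𝓡 3) ∞ H]
    (g : BilinField (𝓡 4) X) (Φ : X ≃ₘ^∞⟮𝓡 4, 𝓡∂ 4⟯ (interiorOpens M)) (ι : H → M)
    (Ω : M → ℝ) (q : BilinField (𝓡∂ 4) M) (N : ∀ p : M, TangentSpace (𝓡∂ 4) p) : Prop where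
  vacuum : IsVacuumSpacetime g
  ι_embedding : IsSmoothEmbedding (𝓡 3) (𝓡∂ 4) ∞ ι
  range_ι : range ι = (𝓡∂ 4).boundary M
  Ω_smooth : ContMDiff (𝓡∂ 4) 𝓘(ℝ, ℝ) ∞ Ω
  Ω_ne_zero : ∀ x : X, Ω (Φ x) ≠ 0
  Ω_eq_zero : ∀ p : H, Ω (ι p) = 0
  dΩ_ne_zero : ∀ p : H, differential (𝓡∂ 4) Ω (ι p) ≠ 0
  q_smooth : IsSmoothBilinField (𝓡∂ 4) q
  q_eq : ∀ (x : X) (u v : TangentSpace (𝓡 4) x),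
    pullback (𝓡∂ 4) (𝓡 4) (fun x : X ↦ (Φ x : M)) q x u v =
      Ω (Φ x) ^ 2 * (g x u v + (Ω (Φ x) ^ 4)⁻¹ *
        (differential (𝓡 4) (fun x : X ↦ Ω (Φ x)) x u *
          differential (𝓡 4) (fun x : X ↦ Ω (Φ x)) x v))
  N_smooth : IsSmoothVectorField (𝓡∂ 4) N
  -- `w = Ω⁻⁴ g^♯(dΩ, ·)` is the vector with `g(w, ·) = Ω⁻⁴ dΩ`, and `N` is its image in `M`
  N_eq : ∀ x : X, ∃ w : TangentSpace (𝓡 4) x,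
    (∀ v, g x w v = (Ω (Φ x) ^ 4)⁻¹ * differential (𝓡 4) (fun x : X ↦ Ω (Φ x)) x v) ∧
      N (Φ x : M) = mfderiv (𝓡 4) (𝓡∂ 4) (fun x : X ↦ (Φ x : M)) x w
  q_lorentzian : ∀ p : H, IsLorentzian 3 (pullback (𝓡∂ 4) (𝓡 3) ι q p)

/-- The vacuum spacetime `(X, g)` is asymptotically Minkowskian at spatial infinity, with asymptote
`(H, q)`: moreover `H` has the topology of `ℝ × S²` and is geodesically complete. -/
structure IsAMSI {X M H : Type*}
    [TopologicalSpace X] [ChartedSpace (EuclideanSpace ℝ (Fin 4)) X] [IsManifold (𝓡 4) ∞ X]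
    [TopologicalSpace M] [ChartedSpace (EuclideanHalfSpace 4) M] [IsManifold (𝓡∂ 4) ∞ M]
    [TopologicalSpace H] [ChartedSpace (EuclideanSpace ℝ (Fin 3)) H] [IsManifold (𝓡 3) ∞ H]
    (g : BilinField (𝓡 4) X) (Φ : X ≃ₘ^∞⟮𝓡 4, 𝓡∂ 4⟯ (interiorOpens M)) (ι : H → M)
    (Ω : M → ℝ) (q : BilinField (𝓡∂ 4) M) (N : ∀ p : M, TangentSpace (𝓡∂ 4) p) : Prop
    extends IsAsymptote g Φ ι Ω q N where
  topology : Nonempty (H ≃ₜ ℝ × Metric.sphere (0 : EuclideanSpace ℝ (Fin 3)) 1)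
  complete : IsGeodesicallyComplete (pullback (𝓡∂ 4) (𝓡 3) ι q)

/-- The function `F = N^a ∇_a Ω` on `M`. -/
def digamma {M : Type*} [TopologicalSpace M] [ChartedSpace (EuclideanHalfSpace 4) M]
    (Ω : M → ℝ) (N : ∀ p : M, TangentSpace (𝓡∂ 4) p) (p : M) : ℝ :=
  differential (𝓡∂ 4) Ω p (N p)

end SpatialInfinity

end

noncomputable section

namespace SpatialInfinity

/-! ### Pointwise algebra of the physical connection near the boundary -/

/-! Near a point of ℋ use coordinates (Ω, x^1, x^2, x^3) whose x^i restrict to a chart of ℋ; the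
index 0 refers to Ω. Off ℋ the physical metric is g̃ = Ω⁻² q − Ω⁻⁴ dΩ², and lowering N with q gives
q(v, N) = Ω⁻² (1 + F) dΩ(v) (`IsAsymptote.q_normal`). Hence q(∂_i, N) = 0 and F = N^0 = −1 + Ω²
q(∂_0, N). The right-hand side is smooth up to ℋ, so F = −1 there.

The same relations make the inverse of g̃ polynomial in Ω, q, N and the inverse h of the tangential
block of q. The Christoffel symbols of g̃ are then explicit: Γ^k_{ij} is smooth up to ℋ and
restricts to the Levi-Civita connection of (ℋ, q); Γ^0_{ij} = Ω A_ij with A_ij = F q_ij on ℋ;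
Γ^0_{0j} = O(Ω); and there are poles Γ^0_{00} ~ 2F/Ω and Γ^k_{0j} ~ −δ^k_j/Ω. In the tangential
components of the Ricci tensor every pole is multiplied by some Γ^0_{ij}, so these components extend
continuously to ℋ (`limitRicci`, `ricci_interior`). They vanish in the interior, which is dense,
hence also on ℋ, where they equal r_ij − 2 A_ij = r_ij + 2 q_ij (`tangentialRicci_eq`). So r_ij = −2
q_ij = 2F q_ij.

To take the limit at boundary points, everything is written with derivatives along a frame on the
manifold with boundary, dual to the coordinate functions (`exists_isDualFrame`). `IsAdapted`
compares it with honest charts, of the spacetime on one side and of ℋ on the other. -/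

/-- The values at a point of the conformal factor `w`, of the components of `q` and `N`, of the
inverse `h` of the tangential block of `q`, and of the derivatives `dq a b c = ∂_a q_{bc}`. -/
structure AsymptoticJet where
  /-- the conformal factor -/
  w : ℝ
  /-- the components of the rescaled metric -/
  q : Matrix (Fin 4) (Fin 4) ℝ
  /-- the components of the normal -/
  N : Fin 4 → ℝ
  /-- the inverse of the tangential block of `q` -/
  h : Matrix (Fin 3) (Fin 3) ℝ
  /-- the first derivatives of `q` -/
  dq : Fin 4 → Fin 4 → Fin 4 → ℝ

namespace AsymptoticJet

variable (J : AsymptoticJet)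

/-- The Christoffel symbols of the first kind of `q`. -/
def lower (a b c : Fin 4) : ℝ := (1 / 2) * (J.dq a b c + J.dq b a c - J.dq c a b)

/-- `q(N, ∂_0)`. -/
def normalPart : ℝ := ∑ c, J.q 0 c * J.N c

/-- `Ω⁻²` times the tangential block of the inverse of the physical metric. -/
def tangentialInv (k l : Fin 3) : ℝ :=
  J.h k l - J.w ^ 2 * J.N k.succ * ∑ m, J.q 0 m.succ * J.h m l

/-- The tangential Christoffel symbols `Γ^k_{ij}` of the physical metric. -/
def tangential (k i j : Fin 3) : ℝ :=
  (∑ l, J.tangentialInv k l * J.lower i.succ j.succ l.succ)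
    + J.N k.succ * (J.w ^ 2 * J.lower i.succ j.succ 0 + J.w * J.q i.succ j.succ)

/-- `Ω⁻¹ Γ^0_{ij}`. -/
def extrinsic (i j : Fin 3) : ℝ :=
  J.w * (∑ c, J.N c * J.lower i.succ j.succ c) + J.N 0 * J.q i.succ j.succ

/-- `Ω⁻¹ Γ^0_{0j}`. -/
def acceleration (j : Fin 3) : ℝ :=
  J.w * (∑ c, J.N c * J.lower 0 j.succ c) + J.N 0 * J.q 0 j.succ

/-- `Γ^0_{00} - 2 F Ω⁻¹`. -/
def radial : ℝ :=
  J.w ^ 2 * (∑ c, J.N c * J.lower 0 0 c) - 2 * J.w * J.normalPart + J.w * J.N 0 * J.q 0 0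

/-- `Γ^k_{0j} + Ω⁻¹ δ^k_j`. -/
def mixed (k j : Fin 3) : ℝ :=
  J.w * J.N k.succ * J.q 0 j.succ + (∑ l, J.tangentialInv k l * J.lower 0 j.succ l.succ)
    + J.w ^ 2 * J.N k.succ * J.lower 0 j.succ 0

/-- The algebraic relations that hold at the points where `Ω ≠ 0`. -/
structure IsInterior : Prop where
  w_ne_zero : J.w ≠ 0
  q_symm : ∀ a b, J.q a b = J.q b a
  dq_symm : ∀ a b c, J.dq a b c = J.dq a c b
  h_mul_q : ∀ i j, ∑ l, J.h i l * J.q l.succ j.succ = if i = j then 1 else 0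
  q_N_tangential : ∀ i : Fin 3, ∑ c, J.q i.succ c * J.N c = 0
  N_zero : J.N 0 = -1 + J.w ^ 2 * J.normalPart

/-- The components `Ω⁻² q - Ω⁻⁴ dΩ ⊗ dΩ` of the physical metric. -/
def phys : Matrix (Fin 4) (Fin 4) ℝ :=
  Matrix.of fun a b ↦ (J.w ^ 2)⁻¹ * J.q a b - (J.w ^ 4)⁻¹ * (if a = 0 ∧ b = 0 then 1 else 0)

/-- The components of the inverse of the physical metric. -/
def physInv : Matrix (Fin 4) (Fin 4) ℝ :=
  Matrix.of (Fin.cons (fun b ↦ J.w ^ 4 * J.N b)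
    (fun k ↦ Fin.cons (J.w ^ 4 * J.N k.succ) (fun l ↦ J.w ^ 2 * J.tangentialInv k l)))

@[simp] theorem physInv_zero (b : Fin 4) : J.physInv 0 b = J.w ^ 4 * J.N b := rfl

@[simp] theorem physInv_succ_zero (k : Fin 3) : J.physInv k.succ 0 = J.w ^ 4 * J.N k.succ := rfl

@[simp] theorem physInv_succ_succ (k l : Fin 3) :
    J.physInv k.succ l.succ = J.w ^ 2 * J.tangentialInv k l := rfl

variable {J}

/-! ### The inverse of the physical metric -/

theorem IsInterior.N_succ (H : J.IsInterior) (k : Fin 3) :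
    J.N k.succ = - J.N 0 * ∑ l, J.h k l * J.q l.succ 0 := by
  have h1 : ∑ l, J.h k l * ∑ c, J.q l.succ c * J.N c = 0 := by simp [H.q_N_tangential]
  have h2 : ∑ j : Fin 3, (∑ l, J.h k l * J.q l.succ j.succ) * J.N j.succ = J.N k.succ := by
    simp [H.h_mul_q]
  simp only [Fin.sum_univ_succ (n := 3), Fin.sum_univ_three] at h1 h2 ⊢
  linear_combination h1 - h2

/-- If N^0 vanished, `N_succ` would make N vanish altogether, and the normalisation of N^0 would
read 0 = −1. -/
theorem IsInterior.N_zero_ne_zero (H : J.IsInterior) : J.N 0 ≠ 0 := by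
  intro h0
  have h1 : ∀ k : Fin 3, J.N k.succ = 0 := fun k ↦ by rw [H.N_succ, h0]; ring
  have h2 := H.N_zero
  simp [normalPart, Fin.sum_univ_succ (n := 3), h0, h1] at h2

theorem IsInterior.sum_shift_mul (H : J.IsInterior) (j : Fin 3) :
    ∑ l, (∑ m, J.q 0 m.succ * J.h m l) * J.q l.succ j.succ = J.q 0 j.succ := by
  have h2 : ∑ m : Fin 3, J.q 0 m.succ * (∑ l, J.h m l * J.q l.succ j.succ) = J.q 0 j.succ := by
    simp [H.h_mul_q]
  rw [← h2]
  simp only [Finset.sum_mul, Finset.mul_sum]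
  rw [Finset.sum_comm]
  simp only [mul_assoc]

theorem IsInterior.tangentialInv_mul (H : J.IsInterior) (k j : Fin 3) :
    ∑ l, J.tangentialInv k l * J.q l.succ j.succ
      = (if k = j then 1 else 0) - J.w ^ 2 * J.N k.succ * J.q 0 j.succ := by
  rw [← H.h_mul_q k j, ← H.sum_shift_mul j]
  simp only [tangentialInv, Fin.sum_univ_three]
  ring

theorem IsInterior.tangentialInv_mul_zero (H : J.IsInterior) (k : Fin 3) :
    ∑ l, J.tangentialInv k l * J.q l.succ 0 = J.N k.succ * (1 - J.w ^ 2 * J.q 0 0) := by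
  have hN := H.N_succ
  have h0 := H.N_zero
  simp only [normalPart, Fin.sum_univ_succ (n := 3)] at h0
  -- After multiplication by N^0, `N_succ` turns N^0 h^{kl} q_{l0} into −N^k, and the normalisation
  -- of N^0 finishes; the factor N^0 is then cancelled.
  have key : J.N 0 * (∑ l, J.tangentialInv k l * J.q l.succ 0)
      = J.N 0 * (J.N k.succ * (1 - J.w ^ 2 * J.q 0 0)) := by
    have e1 : J.N 0 * (∑ l, J.tangentialInv k l * J.q l.succ 0)
        = - J.N k.succ + J.w ^ 2 * J.N k.succ * ∑ m : Fin 3, J.q 0 m.succ * J.N m.succ := by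
      simp only [hN, tangentialInv, Fin.sum_univ_three]
      ring
    rw [e1]
    linear_combination (-J.N k.succ) * h0
  exact mul_left_cancel₀ H.N_zero_ne_zero key

/-- N lowered by q is a multiple of dΩ. This is what makes Ω⁴ N the row of index 0 of the inverse
metric. -/
theorem IsInterior.sum_N_mul_q (H : J.IsInterior) (b : Fin 4) :
    ∑ c, J.N c * J.q c b = if b = 0 then J.normalPart else 0 := by
  simp_rw [H.q_symm _ b, mul_comm (J.N _)]
  refine Fin.cases ?_ (fun i ↦ ?_) b
  · simp [normalPart]
  · simp [H.q_N_tangential]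

/-- In the tangential rows the terms Ω² N^k q_{0b} coming from the entry Ω⁴ N^k cancel the failure
of `tangentialInv` to invert the tangential block exactly. -/
theorem IsInterior.physInv_mul_phys (H : J.IsInterior) : J.physInv * J.phys = 1 := by
  have hw := H.w_ne_zero
  ext a b
  rw [Matrix.mul_apply]
  refine Fin.cases ?_ (fun k ↦ ?_) a
  · have h1 := H.sum_N_mul_q b
    have h0 := H.N_zero
    have h2 : ∑ c, J.physInv 0 c * J.phys c b
        = J.w ^ 2 * (∑ c, J.N c * J.q c b) - J.N 0 * if b = 0 then 1 else 0 := by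
      simp only [physInv_zero, phys, Matrix.of_apply, Fin.sum_univ_succ (n := 3),
        Fin.sum_univ_three, Fin.succ_ne_zero, false_and, if_false, true_and]
      field_simp
      ring
    rw [h2, h1, Matrix.one_apply]
    by_cases hb : b = 0
    · subst hb; simp; linear_combination -h0
    · simp [hb, Ne.symm hb]
  · have h2 : ∑ c, J.physInv k.succ c * J.phys c b
        = J.w ^ 2 * J.N k.succ * J.q 0 b + (∑ l, J.tangentialInv k l * J.q l.succ b)
          - J.N k.succ * if b = 0 then 1 else 0 := by
      simp only [physInv_succ_zero, physInv_succ_succ, phys, Matrix.of_apply,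
        Fin.sum_univ_succ (n := 3),
        Fin.sum_univ_three, Fin.succ_ne_zero, false_and, if_false, true_and]
      field_simp
      ring
    rw [h2, Matrix.one_apply]
    refine Fin.cases ?_ (fun j ↦ ?_) b
    · rw [H.tangentialInv_mul_zero]; simp; ring
    · rw [H.tangentialInv_mul]; simp

theorem IsInterior.phys_inv (H : J.IsInterior) : J.phys⁻¹ = J.physInv :=
  Matrix.inv_eq_left_inv H.physInv_mul_phys

/-! ### The Christoffel symbols of the physical metric -/

variable (J) in
/-- The derivatives `∂_a g_{bc}` of the components of the physical metric. -/
def dphys (a b c : Fin 4) : ℝ :=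
  (J.w ^ 2)⁻¹ * J.dq a b c - 2 * (J.w ^ 3)⁻¹ * (if a = 0 then 1 else 0) * J.q b c
    + 4 * (J.w ^ 5)⁻¹ * (if a = 0 then 1 else 0) * (if b = 0 ∧ c = 0 then 1 else 0)

variable (J) in
/-- The Christoffel symbols of the physical metric. -/
def connection (k a b : Fin 4) : ℝ :=
  (1 / 2) * ∑ l, J.phys⁻¹ k l * (J.dphys a b l + J.dphys b a l - J.dphys l a b)

theorem IsInterior.connection_symm (H : J.IsInterior) (k a b : Fin 4) :
    J.connection k a b = J.connection k b a := by
  have : ∀ l, J.dphys l a b = J.dphys l b a := fun l ↦ by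
    simp only [dphys, H.q_symm a b, H.dq_symm l a b, and_comm]
  simp only [connection, this, add_comm]

/-- The factor Ω⁴ of the row Ω⁴ N clears all negative powers of Ω except the Ω⁻⁵ from the derivative
of Ω⁻⁴ dΩ², which leaves a pole in Γ^0_{00} alone. -/
theorem IsInterior.connection_zero (H : J.IsInterior) (a b : Fin 4) :
    J.connection 0 a b = J.w ^ 2 * (∑ c, J.N c * J.lower a b c)
      - J.w * ((if a = 0 then 1 else 0) * (∑ c, J.N c * J.q b c)
        + (if b = 0 then 1 else 0) * (∑ c, J.N c * J.q a c) - J.N 0 * J.q a b)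
      + 2 * J.w⁻¹ * J.N 0 * (if a = 0 then 1 else 0) * (if b = 0 then 1 else 0) := by
  have hw := H.w_ne_zero
  simp only [connection, H.phys_inv, physInv_zero, dphys, lower]
  simp only [Fin.sum_univ_succ (n := 3), Fin.sum_univ_three, Fin.succ_ne_zero, and_false,
    if_false, and_true]
  by_cases ha : a = 0 <;> by_cases hb : b = 0 <;> simp only [ha, hb, if_true, if_false, and_self,
    and_false, false_and] <;> field_simp <;> ring

theorem IsInterior.connection_succ (H : J.IsInterior) (k : Fin 3) (a b : Fin 4) :
    J.connection k.succ a b = (∑ l, J.tangentialInv k l * J.lower a b l.succ)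
      + J.w ^ 2 * J.N k.succ * J.lower a b 0
      - J.w⁻¹ * ((if a = 0 then 1 else 0) * (∑ l, J.tangentialInv k l * J.q b l.succ)
        + (if b = 0 then 1 else 0) * (∑ l, J.tangentialInv k l * J.q a l.succ))
      - J.w * J.N k.succ * ((if a = 0 then 1 else 0) * J.q b 0
        + (if b = 0 then 1 else 0) * J.q a 0 - J.q a b)
      + 2 * J.w⁻¹ * J.N k.succ * (if a = 0 then 1 else 0) * (if b = 0 then 1 else 0) := by
  have hw := H.w_ne_zero
  simp only [connection, H.phys_inv, physInv_succ_zero, physInv_succ_succ, dphys, lower,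
    Fin.sum_univ_succ (n := 3)]
  simp only [Fin.sum_univ_three, Fin.succ_ne_zero, and_false,
    if_false, and_true]
  by_cases ha : a = 0 <;> by_cases hb : b = 0 <;> simp only [ha, hb, if_true, if_false, and_self,
    and_false, false_and] <;> field_simp <;> ring

theorem IsInterior.connection_zero_succ_succ (H : J.IsInterior) (i j : Fin 3) :
    J.connection 0 i.succ j.succ = J.w * J.extrinsic i j := by
  rw [H.connection_zero, extrinsic]; simp; ring

theorem IsInterior.connection_zero_zero_succ (H : J.IsInterior) (j : Fin 3) :
    J.connection 0 0 j.succ = J.w * J.acceleration j := by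
  rw [H.connection_zero, acceleration]
  simp_rw [H.q_symm j.succ, H.sum_N_mul_q]
  simp
  ring

theorem IsInterior.connection_zero_zero_zero (H : J.IsInterior) :
    J.connection 0 0 0 = J.radial + 2 * J.N 0 * J.w⁻¹ := by
  rw [H.connection_zero, radial]
  simp only [normalPart, mul_comm (J.N _) (J.q 0 _), if_true]
  ring

theorem IsInterior.connection_succ_succ_succ (H : J.IsInterior) (k i j : Fin 3) :
    J.connection k.succ i.succ j.succ = J.tangential k i j := by
  rw [H.connection_succ, tangential]; simp; ring

/-- The pole comes from ∂_0 (Ω⁻²) = −2 Ω⁻³ on the tangential block. Since `tangentialInv` inverts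
that block up to order Ω², what remains is regular. -/
theorem IsInterior.connection_succ_zero_succ (H : J.IsInterior) (k j : Fin 3) :
    J.connection k.succ 0 j.succ = J.mixed k j - J.w⁻¹ * (if k = j then 1 else 0) := by
  have hw := H.w_ne_zero
  rw [H.connection_succ, mixed]
  simp_rw [H.q_symm j.succ, H.tangentialInv_mul]
  simp only [if_true, Fin.succ_ne_zero, if_false]
  field_simp
  ring

end AsymptoticJet

/-! ### Derivatives along vector fields -/

section FrameDeriv

variable {E : Type*} [NormedAddCommGroup E] [NormedSpace ℝ E]
  {K : Type*} [TopologicalSpace K] {I : ModelWithCorners ℝ E K}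
  {M : Type*} [TopologicalSpace M] [ChartedSpace K M]

/-- The derivative `X f` of a function along a vector field. -/
def frameDeriv (X : ∀ m : M, TangentSpace I m) (f : M → ℝ) (m : M) : ℝ :=
  mfderiv I 𝓘(ℝ, ℝ) f m (X m)

/-- X f is the fibre component of the tangent map of f composed with the section X, hence smooth
also at boundary points of O. -/
theorem contMDiffOn_frameDeriv [IsManifold I ∞ M] {O : Set M} (hO : IsOpen O)
    {X : ∀ m : M, TangentSpace I m} {f : M → ℝ}
    (hX : ContMDiffOn I I.tangent ∞ (fun m ↦ (⟨m, X m⟩ : TangentBundle I M)) O)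
    (hf : ContMDiffOn I 𝓘(ℝ, ℝ) ∞ f O) :
    ContMDiffOn I 𝓘(ℝ, ℝ) ∞ (frameDeriv X f) O := by
  have h1 := hf.contMDiffOn_tangentMapWithin (m := ∞) (by simp) hO.uniqueMDiffOn
  have h2 := h1.comp hX (fun m hm ↦ hm)
  have h3 := (contMDiff_snd_tangentBundle_modelSpace ℝ 𝓘(ℝ, ℝ) (n := ∞)).comp_contMDiffOn h2
  refine h3.congr fun m hm ↦ ?_
  change mfderiv I 𝓘(ℝ, ℝ) f m (X m) = mfderivWithin I 𝓘(ℝ, ℝ) f O m (X m)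
  rw [mfderivWithin_of_isOpen hO hm]

theorem frameDeriv_mul {X : ∀ m : M, TangentSpace I m} {f g : M → ℝ} {m : M}
    (hf : MDifferentiableAt I 𝓘(ℝ, ℝ) f m) (hg : MDifferentiableAt I 𝓘(ℝ, ℝ) g m) :
    frameDeriv X (fun x ↦ f x * g x) m = f m * frameDeriv X g m + g m * frameDeriv X f m := by
  have := (hf.hasMFDerivAt.mul hg.hasMFDerivAt).mfderiv
  simp only [frameDeriv]
  erw [this]
  rfl

theorem frameDeriv_congr {X : ∀ m : M, TangentSpace I m} {f g : M → ℝ} {m : M}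
    (h : f =ᶠ[𝓝 m] g) : frameDeriv X f m = frameDeriv X g m := by
  simp only [frameDeriv]; rw [h.mfderiv_eq]; rfl

theorem partialDeriv_congr {n : ℕ} {f g : EuclideanSpace ℝ (Fin n) → ℝ}
    {z : EuclideanSpace ℝ (Fin n)} (a : Fin n) (h : f =ᶠ[𝓝 z] g) :
    partialDeriv a f z = partialDeriv a g z := by
  simp only [partialDeriv, h.fderiv_eq]

theorem partialDeriv_comp {n : ℕ} {X : ∀ m : M, TangentSpace I m} {f : M → ℝ}
    {σ : EuclideanSpace ℝ (Fin n) → M} {z : EuclideanSpace ℝ (Fin n)} (a : Fin n)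
    (hσ : MDifferentiableAt (𝓡 n) I σ z)
    (hX : mfderiv (𝓡 n) I σ z (EuclideanSpace.single a 1) = X (σ z))
    (hf : MDifferentiableAt I 𝓘(ℝ, ℝ) f (σ z)) :
    partialDeriv a (fun y ↦ f (σ y)) z = frameDeriv X f (σ z) := by
  have := mfderiv_comp z hf hσ
  rw [frameDeriv, ← hX, partialDeriv, ← mfderiv_eq_fderiv]
  change mfderiv _ _ (f ∘ σ) z _ = _
  rw [this]
  rfl

/-! ### Adapted frames -/

/-- The components of the rescaled fields in a frame `fr` on (a part of) `M`. -/
structure FrameFields (I : ModelWithCorners ℝ E K) (M : Type*) [TopologicalSpace M]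
    [ChartedSpace K M] where
  /-- the frame -/
  fr : Fin 4 → ∀ m : M, TangentSpace I m
  /-- the conformal factor -/
  w : M → ℝ
  /-- the components of the rescaled metric -/
  q : M → Matrix (Fin 4) (Fin 4) ℝ
  /-- the components of the normal -/
  N : M → Fin 4 → ℝ
  /-- the inverse of the tangential block of `q` -/
  h : M → Matrix (Fin 3) (Fin 3) ℝ

namespace FrameFields

variable (S : FrameFields I M)

/-- The 1-jet of the fields at a point. -/
def jet (m : M) : AsymptoticJet :=
  ⟨S.w m, S.q m, S.N m, S.h m, fun a b c ↦ frameDeriv (S.fr a) (fun x ↦ S.q x b c) m⟩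

/-- Smoothness of the frame and of the components, on the set `O`. -/
structure IsSmoothOn [IsManifold I ∞ M] (O : Set M) : Prop where
  fr : ∀ a, ContMDiffOn I I.tangent ∞ (fun m ↦ (⟨m, S.fr a m⟩ : TangentBundle I M)) O
  w : ContMDiffOn I 𝓘(ℝ, ℝ) ∞ S.w O
  q : ∀ a b, ContMDiffOn I 𝓘(ℝ, ℝ) ∞ (fun m ↦ S.q m a b) O
  N : ∀ a, ContMDiffOn I 𝓘(ℝ, ℝ) ∞ (fun m ↦ S.N m a) O
  h : ∀ i j, ContMDiffOn I 𝓘(ℝ, ℝ) ∞ (fun m ↦ S.h m i j) O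

/-- The expression of the Ricci tensor through the tangential Christoffel symbols. -/
def tangentialRicci (i j : Fin 3) (m : M) : ℝ :=
  ∑ k : Fin 3, (frameDeriv (S.fr k.succ) (fun x ↦ (S.jet x).tangential k j i) m
    - frameDeriv (S.fr j.succ) (fun x ↦ (S.jet x).tangential k k i) m
    + ∑ l, ((S.jet m).tangential k k l * (S.jet m).tangential l j i
      - (S.jet m).tangential k j l * (S.jet m).tangential l k i))

/-- The tangential components of the Ricci tensor of the physical metric, in a form that makes
sense up to the boundary. -/
def limitRicci (i j : Fin 3) (m : M) : ℝ :=
  S.tangentialRicci i j m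
    + ((S.jet m).extrinsic j i + S.w m * frameDeriv (S.fr 0) (fun x ↦ (S.jet x).extrinsic j i) m)
    - S.w m * frameDeriv (S.fr j.succ) (fun x ↦ (S.jet x).acceleration i) m
    + (S.w m * (S.jet m).radial + 2 * S.N m 0) * (S.jet m).extrinsic j i
    + ∑ l, S.w m * (S.jet m).acceleration l * (S.jet m).tangential l j i
    - S.w m ^ 2 * (S.jet m).acceleration j * (S.jet m).acceleration i
    - ∑ l, (S.jet m).extrinsic j l * (S.w m * (S.jet m).mixed l i - if l = i then 1 else 0)
    + ∑ k, (S.w m * (S.jet m).mixed k k - 1) * (S.jet m).extrinsic j i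
    - ∑ k, (S.w m * (S.jet m).mixed k j - if k = j then 1 else 0) * (S.jet m).extrinsic k i

/-! ### Regularity up to the boundary, and the limit at the boundary -/

namespace IsSmoothOn

variable {S} [IsManifold I ∞ M] {O : Set M}

theorem dq (hS : S.IsSmoothOn O) (hO : IsOpen O) (a b c : Fin 4) :
    ContMDiffOn I 𝓘(ℝ, ℝ) ∞ (fun m ↦ (S.jet m).dq a b c) O :=
  contMDiffOn_frameDeriv hO (hS.fr a) (hS.q b c)

theorem lower (hS : S.IsSmoothOn O) (hO : IsOpen O) (a b c : Fin 4) :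
    ContMDiffOn I 𝓘(ℝ, ℝ) ∞ (fun m ↦ (S.jet m).lower a b c) O :=
  contMDiffOn_const.mul (((hS.dq hO a b c).add (hS.dq hO b a c)).sub (hS.dq hO c a b))

theorem sum_N_mul_lower (hS : S.IsSmoothOn O) (hO : IsOpen O) (a b : Fin 4) :
    ContMDiffOn I 𝓘(ℝ, ℝ) ∞ (fun m ↦ ∑ c, (S.jet m).N c * (S.jet m).lower a b c) O :=
  contMDiffOn_finsetSum fun c _ ↦ (hS.N c).mul (hS.lower hO a b c)

theorem normalPart (hS : S.IsSmoothOn O) :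
    ContMDiffOn I 𝓘(ℝ, ℝ) ∞ (fun m ↦ (S.jet m).normalPart) O :=
  contMDiffOn_finsetSum fun c _ ↦ (hS.q 0 c).mul (hS.N c)

theorem tangentialInv (hS : S.IsSmoothOn O) (k l : Fin 3) :
    ContMDiffOn I 𝓘(ℝ, ℝ) ∞ (fun m ↦ (S.jet m).tangentialInv k l) O :=
  (hS.h k l).sub (((hS.w.pow 2).mul (hS.N k.succ)).mul
    (contMDiffOn_finsetSum fun m _ ↦ (hS.q 0 m.succ).mul (hS.h m l)))

theorem tangential (hS : S.IsSmoothOn O) (hO : IsOpen O) (k i j : Fin 3) :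
    ContMDiffOn I 𝓘(ℝ, ℝ) ∞ (fun m ↦ (S.jet m).tangential k i j) O :=
  (contMDiffOn_finsetSum fun l _ ↦ (hS.tangentialInv k l).mul (hS.lower hO _ _ _)).add
    ((hS.N k.succ).mul (((hS.w.pow 2).mul (hS.lower hO _ _ _)).add (hS.w.mul (hS.q _ _))))

theorem extrinsic (hS : S.IsSmoothOn O) (hO : IsOpen O) (i j : Fin 3) :
    ContMDiffOn I 𝓘(ℝ, ℝ) ∞ (fun m ↦ (S.jet m).extrinsic i j) O :=
  (hS.w.mul (hS.sum_N_mul_lower hO _ _)).add ((hS.N 0).mul (hS.q _ _))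

theorem acceleration (hS : S.IsSmoothOn O) (hO : IsOpen O) (j : Fin 3) :
    ContMDiffOn I 𝓘(ℝ, ℝ) ∞ (fun m ↦ (S.jet m).acceleration j) O :=
  (hS.w.mul (hS.sum_N_mul_lower hO _ _)).add ((hS.N 0).mul (hS.q _ _))

theorem radial (hS : S.IsSmoothOn O) (hO : IsOpen O) :
    ContMDiffOn I 𝓘(ℝ, ℝ) ∞ (fun m ↦ (S.jet m).radial) O :=
  (((hS.w.pow 2).mul (hS.sum_N_mul_lower hO _ _)).sub
    ((contMDiffOn_const.mul hS.w).mul (hS.normalPart))).add ((hS.w.mul (hS.N 0)).mul (hS.q _ _))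

theorem mixed (hS : S.IsSmoothOn O) (hO : IsOpen O) (k j : Fin 3) :
    ContMDiffOn I 𝓘(ℝ, ℝ) ∞ (fun m ↦ (S.jet m).mixed k j) O :=
  (((hS.w.mul (hS.N _)).mul (hS.q _ _)).add
    (contMDiffOn_finsetSum fun l _ ↦ (hS.tangentialInv k l).mul (hS.lower hO _ _ _))).add
    (((hS.w.pow 2).mul (hS.N _)).mul (hS.lower hO _ _ _))

theorem tangentialRicci (hS : S.IsSmoothOn O) (hO : IsOpen O) (i j : Fin 3) :
    ContinuousOn (S.tangentialRicci i j) O :=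
  continuousOn_finsetSum _ fun _ _ ↦
    (((contMDiffOn_frameDeriv hO (hS.fr _) (hS.tangential hO _ _ _)).continuousOn).sub
      (contMDiffOn_frameDeriv hO (hS.fr _) (hS.tangential hO _ _ _)).continuousOn).add
      (continuousOn_finsetSum _ fun _ _ ↦
        (((hS.tangential hO _ _ _).mul (hS.tangential hO _ _ _)).sub
          ((hS.tangential hO _ _ _).mul (hS.tangential hO _ _ _))).continuousOn)

theorem limitRicci (hS : S.IsSmoothOn O) (hO : IsOpen O) (i j : Fin 3) :
    ContinuousOn (S.limitRicci i j) O := by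
  have hw := hS.w.continuousOn
  have hN := (hS.N 0).continuousOn
  have hA := fun i j ↦ (hS.extrinsic hO i j).continuousOn
  have hB := fun i j ↦ (hS.mixed hO i j).continuousOn
  have hC := fun i ↦ (hS.acceleration hO i).continuousOn
  have hP := fun k i j ↦ (hS.tangential hO k i j).continuousOn
  have hZ := (hS.radial hO).continuousOn
  have hdA := (contMDiffOn_frameDeriv hO (hS.fr 0) (hS.extrinsic hO j i)).continuousOn
  have hdC := (contMDiffOn_frameDeriv hO (hS.fr j.succ) (hS.acceleration hO i)).continuousOn
  have hR := hS.tangentialRicci hO i j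
  unfold FrameFields.limitRicci
  fun_prop

/-- At a boundary point, the vanishing of the physical Ricci tensor is an equation for the
tangential metric. -/
theorem tangentialRicci_eq (hS : S.IsSmoothOn O) (hO : IsOpen O) {V : Set M} {p : M}
    (hp : p ∈ O) (hVO : V ⊆ O)
    (hpV : p ∈ closure V) (hw : S.w p = 0)
    (hN : ∀ m ∈ V, S.N m 0 = -1 + S.w m ^ 2 * (S.jet m).normalPart)
    {i j : Fin 3} (hR : ∀ m ∈ V, S.limitRicci i j m = 0) :
    S.N p 0 = -1 ∧ S.tangentialRicci i j p = -2 * S.q p j.succ i.succ := by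
  -- The limiting argument: functions continuous on O that agree on V agree at its limit point p.
  have hcl : ∀ {f g : M → ℝ}, ContinuousOn f O → ContinuousOn g O → EqOn f g V → f p = g p := by
    intro f g hf hg hfg
    have hne : (𝓝[V] p).NeBot := mem_closure_iff_nhdsWithin_neBot.1 hpV
    have h1 : Filter.Tendsto f (𝓝[V] p) (𝓝 (f p)) := (hf p hp).mono hVO
    have h2 : Filter.Tendsto g (𝓝[V] p) (𝓝 (g p)) := (hg p hp).mono hVO
    refine tendsto_nhds_unique h1 (h2.congr' ?_)
    filter_upwards [self_mem_nhdsWithin] with m hm using (hfg hm).symm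
  have hN0 : S.N p 0 = -1 := by
    have := hcl (hS.N 0).continuousOn
      (contMDiffOn_const.add ((hS.w.pow 2).mul (hS.normalPart))).continuousOn hN
    simpa [hw] using this
  refine ⟨hN0, ?_⟩
  have h0 := hcl (hS.limitRicci hO i j) continuousOn_const hR
  have hA : ∀ k l, (S.jet p).extrinsic k l = - S.q p k.succ l.succ := fun k l ↦ by
    simp [AsymptoticJet.extrinsic, jet, hw, hN0]
  -- With A the extrinsic term, the surviving terms are r_ij + (1 − 2 + 1 − 3 + 1) A_ji: in order,
  -- from ∂_0 (Ω A), from the pole of Γ^0_{00}, and from the three sums over δ, of which −3 is a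
  -- trace.
  simp only [FrameFields.limitRicci, hA, hw, hN0] at h0
  simp at h0
  linarith

end IsSmoothOn

end FrameFields

end FrameDeriv

theorem partialDeriv_phys {n : ℕ} {u f : EuclideanSpace ℝ (Fin n) → ℝ}
    {z : EuclideanSpace ℝ (Fin n)} (a : Fin n) (c : ℝ) (hu : DifferentiableAt ℝ u z)
    (hf : DifferentiableAt ℝ f z) (h0 : u z ≠ 0) :
    partialDeriv a (fun y ↦ (u y ^ 2)⁻¹ * f y - (u y ^ 4)⁻¹ * c) z
      = (u z ^ 2)⁻¹ * partialDeriv a f z - 2 * (u z ^ 3)⁻¹ * partialDeriv a u z * f z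
        + 4 * (u z ^ 5)⁻¹ * partialDeriv a u z * c := by
  set v : EuclideanSpace ℝ (Fin n) := EuclideanSpace.single a 1
  -- Restriction to the line z + t v reduces the computation to derivatives in one variable.
  have line : ∀ F : EuclideanSpace ℝ (Fin n) → ℝ, DifferentiableAt ℝ F z →
      HasDerivAt (fun t : ℝ ↦ F (z + t • v)) (partialDeriv a F z) 0 := fun F hF ↦
    (hF.hasFDerivAt.hasLineDerivAt v)
  have hu' := line u hu
  have hf' := line f hf
  have h0' : u (z + (0 : ℝ) • v) ≠ 0 := by simpa using h0
  have h1 := ((hu'.pow 2).inv (pow_ne_zero 2 h0')).mul hf'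
  have h2 := ((hu'.pow 4).inv (pow_ne_zero 4 h0')).mul_const c
  have hd : DifferentiableAt ℝ (fun y ↦ (u y ^ 2)⁻¹ * f y - (u y ^ 4)⁻¹ * c) z :=
    (((hu.pow 2).inv (pow_ne_zero 2 h0)).mul hf).sub
      (((hu.pow 4).inv (pow_ne_zero 4 h0)).mul_const c)
  have h3 := (line _ hd).unique (h1.sub h2)
  rw [h3]
  simp
  field_simp
  ring

/-! ### From frame derivatives to partial derivatives in charts -/

section Transfer

variable {E : Type*} [NormedAddCommGroup E] [NormedSpace ℝ E]
  {K : Type*} [TopologicalSpace K] {I : ModelWithCorners ℝ E K}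
  {M : Type*} [TopologicalSpace M] [ChartedSpace K M]

/-- `σ` parametrises a part of `O` on `U`, and its coordinate vector fields are the vector fields
`X a`. -/
structure IsAdapted {n : ℕ} (X : Fin n → ∀ m : M, TangentSpace I m)
    (σ : EuclideanSpace ℝ (Fin n) → M) (U : Set (EuclideanSpace ℝ (Fin n))) (O : Set M) :
    Prop where
  isOpen : IsOpen U
  mapsTo : MapsTo σ U O
  mdifferentiableAt : ∀ z ∈ U, MDifferentiableAt (𝓡 n) I σ z
  mfderiv_single : ∀ z ∈ U, ∀ a,
    mfderiv (𝓡 n) I σ z (EuclideanSpace.single a 1) = X a (σ z)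

/-- Agreement on the open set U suffices, so a formula for Christoffel symbols that holds on U can
be differentiated. -/
theorem IsAdapted.partialDeriv_eq {n : ℕ} {X : Fin n → ∀ m : M, TangentSpace I m}
    {σ : EuclideanSpace ℝ (Fin n) → M} {U : Set (EuclideanSpace ℝ (Fin n))} {O : Set M}
    (hσ : IsAdapted X σ U O) (hO : IsOpen O) {f : M → ℝ} (hf : ContMDiffOn I 𝓘(ℝ, ℝ) ∞ f O)
    {F : EuclideanSpace ℝ (Fin n) → ℝ} (hF : ∀ z ∈ U, F z = f (σ z))
    {z : EuclideanSpace ℝ (Fin n)} (hz : z ∈ U) (a : Fin n) :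
    partialDeriv a F z = frameDeriv (X a) f (σ z) := by
  have h1 : F =ᶠ[𝓝 z] fun y ↦ f (σ y) := by
    filter_upwards [hσ.isOpen.mem_nhds hz] with y hy using hF y hy
  rw [partialDeriv_congr a h1]
  exact partialDeriv_comp a (hσ.mdifferentiableAt z hz) (hσ.mfderiv_single z hz a)
    ((hf.contMDiffAt (hO.mem_nhds (hσ.mapsTo hz))).mdifferentiableAt (by simp))

namespace FrameFields

variable [IsManifold I ∞ M] {S : FrameFields I M} {O : Set M}

/-- The Ricci tensor of a metric that restricts to the tangential metric at the boundary. -/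
theorem ricci_boundary (hS : S.IsSmoothOn O) (hO : IsOpen O) {σ : EuclideanSpace ℝ (Fin 3) → M}
    {U : Set (EuclideanSpace ℝ (Fin 3))} (hσ : IsAdapted (fun k ↦ S.fr k.succ) σ U O)
    {G : EuclideanSpace ℝ (Fin 3) → Matrix (Fin 3) (Fin 3) ℝ}
    (hG : ∀ z ∈ U, ∀ i j, G z i j = S.q (σ z) i.succ j.succ)
    (hw : ∀ z ∈ U, S.w (σ z) = 0) (hh : ∀ z ∈ U, S.h (σ z) = (G z)⁻¹)
    {z : EuclideanSpace ℝ (Fin 3)} (hz : z ∈ U) (i j : Fin 3) :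
    ricci G i j z = S.tangentialRicci i j (σ z) := by
  -- Where Ω = 0 the corrections in `tangential` drop out, and the Levi-Civita formula with inverse
  -- metric h is left.
  have hc : ∀ k i j, ∀ z ∈ U, christoffel G k i j z = (S.jet (σ z)).tangential k i j := by
    intro k i j z hz
    have hd : ∀ a b c : Fin 3, partialDeriv a (fun y ↦ G y b c) z
        = (S.jet (σ z)).dq a.succ b.succ c.succ := fun a b c ↦
      hσ.partialDeriv_eq hO (hS.q b.succ c.succ) (fun y hy ↦ hG y hy b c) hz a
    simp only [christoffel, hd, ← hh z hz, AsymptoticJet.tangential, AsymptoticJet.tangentialInv,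
      AsymptoticJet.lower]
    simp only [jet, hw z hz, Finset.mul_sum]
    simp only [Fin.sum_univ_three]
    ring
  simp only [ricci, riemann, tangentialRicci]
  refine Finset.sum_congr rfl fun k _ ↦ ?_
  rw [hσ.partialDeriv_eq hO (hS.tangential hO k j i) (hc k j i) hz k,
    hσ.partialDeriv_eq hO (hS.tangential hO k k i) (hc k k i) hz j]
  simp only [hc _ _ _ z hz]

/-- The tangential components of the Ricci tensor of the physical metric. -/
theorem ricci_interior (hS : S.IsSmoothOn O) (hO : IsOpen O)
    (hfr : ∀ m ∈ O, ∀ a, frameDeriv (S.fr a) S.w m = if a = 0 then 1 else 0)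
    {σ : EuclideanSpace ℝ (Fin 4) → M}
    {U : Set (EuclideanSpace ℝ (Fin 4))} (hσ : IsAdapted S.fr σ U O)
    (hI : ∀ z ∈ U, (S.jet (σ z)).IsInterior)
    {G : EuclideanSpace ℝ (Fin 4) → Matrix (Fin 4) (Fin 4) ℝ}
    (hG : ∀ z ∈ U, G z = (S.jet (σ z)).phys)
    {z : EuclideanSpace ℝ (Fin 4)} (hz : z ∈ U) (i j : Fin 3) :
    ricci G i.succ j.succ z = S.limitRicci i j (σ z) := by
  have hdiff : ∀ {f : M → ℝ}, ContMDiffOn I 𝓘(ℝ, ℝ) ∞ f O → ∀ z ∈ U,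
      DifferentiableAt ℝ (fun y ↦ f (σ y)) z := fun {f} hf z hz ↦ by
    have h1 : MDifferentiableAt I 𝓘(ℝ, ℝ) f (σ z) :=
      ((hf.contMDiffAt (hO.mem_nhds (hσ.mapsTo hz))).mdifferentiableAt (by simp))
    exact (h1.comp z (hσ.mdifferentiableAt z hz)).differentiableAt
  have hc : ∀ k a b, ∀ z ∈ U, christoffel G k a b z = (S.jet (σ z)).connection k a b := by
    intro k a b z hz
    have hd : ∀ a b c : Fin 4, partialDeriv a (fun y ↦ G y b c) z
        = (S.jet (σ z)).dphys a b c := by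
      intro a b c
      have h1 : (fun y ↦ G y b c) =ᶠ[𝓝 z] fun y ↦ (S.w (σ y) ^ 2)⁻¹ * S.q (σ y) b c
          - (S.w (σ y) ^ 4)⁻¹ * (if b = 0 ∧ c = 0 then 1 else 0) := by
        filter_upwards [hσ.isOpen.mem_nhds hz] with y hy
        rw [hG y hy]; rfl
      rw [partialDeriv_congr a h1, partialDeriv_phys a _ (hdiff hS.w z hz) (hdiff (hS.q b c) z hz)
        (hI z hz).w_ne_zero, hσ.partialDeriv_eq hO hS.w (fun _ _ ↦ rfl) hz a,
        hσ.partialDeriv_eq hO (hS.q b c) (fun _ _ ↦ rfl) hz a, hfr _ (hσ.mapsTo hz)]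
      rfl
    simp only [christoffel, hd, hG z hz]
    rfl
  have hw := (hI z hz).w_ne_zero
  have hmd : ∀ {f : M → ℝ}, ContMDiffOn I 𝓘(ℝ, ℝ) ∞ f O → MDifferentiableAt I 𝓘(ℝ, ℝ) f (σ z) :=
    fun {f} hf ↦ ((hf.contMDiffAt (hO.mem_nhds (hσ.mapsTo hz))).mdifferentiableAt (by simp))
  -- As ∂_0 Ω = 1, differentiating Γ^0_{ji} = Ω A_ji leaves one term A_ji without a factor Ω, which
  -- survives at the boundary.
  have d1 : partialDeriv 0 (christoffel G 0 j.succ i.succ) z = (S.jet (σ z)).extrinsic j i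
      + S.w (σ z) * frameDeriv (S.fr 0) (fun x ↦ (S.jet x).extrinsic j i) (σ z) := by
    rw [hσ.partialDeriv_eq hO (hS.w.mul (hS.extrinsic hO j i))
      (fun y hy ↦ (hc _ _ _ y hy).trans ((hI y hy).connection_zero_succ_succ j i)) hz 0]
    erw [frameDeriv_mul (hmd hS.w) (hmd (hS.extrinsic hO j i))]
    rw [hfr _ (hσ.mapsTo hz)]
    simp; ring
  have d2 : partialDeriv j.succ (christoffel G 0 0 i.succ) z
      = S.w (σ z) * frameDeriv (S.fr j.succ) (fun x ↦ (S.jet x).acceleration i) (σ z) := by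
    rw [hσ.partialDeriv_eq hO (hS.w.mul (hS.acceleration hO i))
      (fun y hy ↦ (hc _ _ _ y hy).trans ((hI y hy).connection_zero_zero_succ i)) hz j.succ]
    erw [frameDeriv_mul (hmd hS.w) (hmd (hS.acceleration hO i))]
    rw [hfr _ (hσ.mapsTo hz)]
    simp
  have d3 : ∀ a : Fin 4, ∀ k i j : Fin 3, partialDeriv a (christoffel G k.succ i.succ j.succ) z
      = frameDeriv (S.fr a) (fun x ↦ (S.jet x).tangential k i j) (σ z) := fun a k i j ↦
    hσ.partialDeriv_eq hO (hS.tangential hO k i j)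
      (fun y hy ↦ (hc _ _ _ y hy).trans ((hI y hy).connection_succ_succ_succ k i j)) hz a
  have s := (hI z hz).connection_symm
  have e1 : ∀ i j : Fin 3, christoffel G 0 i.succ j.succ z
      = S.w (σ z) * (S.jet (σ z)).extrinsic i j := fun i j ↦
    (hc _ _ _ z hz).trans ((hI z hz).connection_zero_succ_succ i j)
  have e2 : ∀ j : Fin 3, christoffel G 0 0 j.succ z
      = S.w (σ z) * (S.jet (σ z)).acceleration j := fun j ↦
    (hc _ _ _ z hz).trans ((hI z hz).connection_zero_zero_succ j)
  have e2' : ∀ j : Fin 3, christoffel G 0 j.succ 0 z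
      = S.w (σ z) * (S.jet (σ z)).acceleration j := fun j ↦
    (hc _ _ _ z hz).trans ((s _ _ _).trans ((hI z hz).connection_zero_zero_succ j))
  have e3 : christoffel G 0 0 0 z = (S.jet (σ z)).radial + 2 * S.N (σ z) 0 * (S.w (σ z))⁻¹ :=
    (hc _ _ _ z hz).trans (hI z hz).connection_zero_zero_zero
  have e4 : ∀ k j : Fin 3, christoffel G k.succ 0 j.succ z
      = (S.jet (σ z)).mixed k j - (S.w (σ z))⁻¹ * (if k = j then 1 else 0) := fun k j ↦
    (hc _ _ _ z hz).trans ((hI z hz).connection_succ_zero_succ k j)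
  have e4' : ∀ k j : Fin 3, christoffel G k.succ j.succ 0 z
      = (S.jet (σ z)).mixed k j - (S.w (σ z))⁻¹ * (if k = j then 1 else 0) := fun k j ↦
    (hc _ _ _ z hz).trans ((s _ _ _).trans ((hI z hz).connection_succ_zero_succ k j))
  have e5 : ∀ k i j : Fin 3, christoffel G k.succ i.succ j.succ z
      = (S.jet (σ z)).tangential k i j := fun k i j ↦
    (hc _ _ _ z hz).trans ((hI z hz).connection_succ_succ_succ k i j)
  -- The only symbols without a formula here, Γ^k_{00}, do not occur in the tangential components.
  simp only [ricci, riemann, Fin.sum_univ_succ (n := 3), d1, d2, d3, e1, e2, e2', e3, e4, e4', e5]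
  simp only [limitRicci, tangentialRicci]
  have hw' : S.w (σ z) ≠ 0 := hw
  simp only [Finset.sum_add_distrib, Finset.sum_sub_distrib, if_true]
  -- Each pole Ω⁻¹ meets a factor Γ^0_{ij} = Ω A_ij and cancels.
  have r1 : ∀ a b c : ℝ, (a - (S.w (σ z))⁻¹ * b) * (S.w (σ z) * c) = (S.w (σ z) * a - b) * c := by
    intro a b c; field_simp
  have r2 : ∀ a b c : ℝ, (S.w (σ z) * c) * (a - (S.w (σ z))⁻¹ * b) = c * (S.w (σ z) * a - b) := by
    intro a b c; field_simp
  have r3 : (((S.jet (σ z)).radial + 2 * S.N (σ z) 0 * (S.w (σ z))⁻¹)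
      * (S.w (σ z) * (S.jet (σ z)).extrinsic j i))
      = (S.w (σ z) * (S.jet (σ z)).radial + 2 * S.N (σ z) 0) * (S.jet (σ z)).extrinsic j i := by
    field_simp
  simp only [r1, r2, r3]
  ring

end FrameFields

end Transfer

/-! ### Smooth dependence of the inverse of a matrix -/

section MatrixInverse

variable {E : Type*} [NormedAddCommGroup E] [NormedSpace ℝ E]
  {K : Type*} [TopologicalSpace K] {I : ModelWithCorners ℝ E K}
  {M : Type*} [TopologicalSpace M] [ChartedSpace K M]
  {ν : Type*} [Fintype ν] [DecidableEq ν] {A : M → Matrix ν ν ℝ} {O : Set M}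

theorem contMDiffOn_matrix_det (hA : ∀ i j, ContMDiffOn I 𝓘(ℝ, ℝ) ∞ (fun m ↦ A m i j) O) :
    ContMDiffOn I 𝓘(ℝ, ℝ) ∞ (fun m ↦ (A m).det) O := by
  simp only [Matrix.det_apply']
  exact contMDiffOn_finsetSum fun s _ ↦ contMDiffOn_const.mul
    (contMDiffOn_finsetProd fun i _ ↦ hA _ _)

/-- By Cramer's rule the entries are quotients of determinants of matrices with smooth entries. -/
theorem contMDiffOn_matrix_inv (hA : ∀ i j, ContMDiffOn I 𝓘(ℝ, ℝ) ∞ (fun m ↦ A m i j) O)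
    (hdet : ∀ m ∈ O, (A m).det ≠ 0) (i j : ν) :
    ContMDiffOn I 𝓘(ℝ, ℝ) ∞ (fun m ↦ (A m)⁻¹ i j) O := by
  simp only [Matrix.inv_def, Matrix.smul_apply, Ring.inverse_eq_inv', smul_eq_mul,
    Matrix.adjugate_apply]
  refine ((contMDiffOn_matrix_det hA).inv₀ hdet).mul (contMDiffOn_matrix_det fun k l ↦ ?_)
  by_cases hk : k = j
  · subst hk
    simpa using contMDiffOn_const
  · simpa [Matrix.updateRow_apply, hk] using hA k l

end MatrixInverse

/-! ### The frame dual to a system of coordinate functions -/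

section DualFrame

variable {n : ℕ} {K : Type*} [TopologicalSpace K]
  {I : ModelWithCorners ℝ (EuclideanSpace ℝ (Fin n)) K}
  {M : Type*} [TopologicalSpace M] [ChartedSpace K M]

/-- `fr` is the frame dual to the differentials of the coordinate functions `t`, on `O`. -/
structure IsDualFrame [IsManifold I ∞ M] (t : Fin n → M → ℝ)
    (fr : Fin n → ∀ m : M, TangentSpace I m)
    (O : Set M) : Prop where
  contMDiffOn : ∀ a, ContMDiffOn I I.tangent ∞ (fun m ↦ (⟨m, fr a m⟩ : TangentBundle I M)) O
  frameDeriv_eq : ∀ m ∈ O, ∀ a b, frameDeriv (fr a) (t b) m = if b = a then 1 else 0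
  eq_zero : ∀ m ∈ O, ∀ v : TangentSpace I m, (∀ b, differential I (t b) m v = 0) → v = 0

theorem IsDualFrame.mono [IsManifold I ∞ M] {t : Fin n → M → ℝ}
    {fr : Fin n → ∀ m : M, TangentSpace I m}
    {O O' : Set M} (h : IsDualFrame t fr O) (hO : O' ⊆ O) : IsDualFrame t fr O' :=
  ⟨fun a ↦ (h.contMDiffOn a).mono hO, fun m hm ↦ h.frameDeriv_eq m (hO hm),
    fun m hm ↦ h.eq_zero m (hO hm)⟩

theorem IsDualFrame.eq_fr [IsManifold I ∞ M] {t : Fin n → M → ℝ}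
    {fr : Fin n → ∀ m : M, TangentSpace I m}
    {O : Set M} (h : IsDualFrame t fr O) {m : M} (hm : m ∈ O) {a : Fin n} {v : TangentSpace I m}
    (hv : ∀ b, differential I (t b) m v = if b = a then 1 else 0) : v = fr a m := by
  rw [← sub_eq_zero]
  refine h.eq_zero m hm _ fun b ↦ ?_
  rw [map_sub, hv, sub_eq_zero]
  exact (h.frameDeriv_eq m hm a b).symm

theorem IsDualFrame.eq_sum [IsManifold I ∞ M] {t : Fin n → M → ℝ}
    {fr : Fin n → ∀ m : M, TangentSpace I m}
    {O : Set M} (h : IsDualFrame t fr O) {m : M} (hm : m ∈ O) (v : TangentSpace I m) :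
    v = ∑ a, differential I (t a) m v • fr a m := by
  rw [← sub_eq_zero]
  refine h.eq_zero m hm _ fun b ↦ ?_
  have h1 : ∀ a, differential I (t b) m (fr a m) = if b = a then 1 else 0 :=
    fun a ↦ h.frameDeriv_eq m hm a b
  simp [map_sub, map_sum, h1]

/-- Differentiate the functions t along any smooth local frame. The resulting matrix is invertible
at p, hence nearby, and the columns of its inverse give the dual frame. No inverse function theorem
is involved, so p may lie on the boundary. -/
theorem exists_isDualFrame [IsManifold I ∞ M] {t : Fin n → M → ℝ} {O : Set M} (hO : IsOpen O)
    {p : M} (hp : p ∈ O)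
    (ht : ∀ a, ContMDiffOn I 𝓘(ℝ, ℝ) ∞ (t a) O)
    (hinj : ∀ v : TangentSpace I p, (∀ b, differential I (t b) p v = 0) → v = 0) :
    ∃ (fr : Fin n → ∀ m : M, TangentSpace I m) (O' : Set M), IsOpen O' ∧ p ∈ O' ∧ O' ⊆ O ∧
      IsDualFrame t fr O' := by
  set e := trivializationAt (EuclideanSpace ℝ (Fin n)) (TangentSpace I : M → Type _) p
  set b : Module.Basis (Fin n) ℝ (EuclideanSpace ℝ (Fin n)) :=
    (EuclideanSpace.basisFun (Fin n) ℝ).toBasis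
  set X : Fin n → ∀ m : M, TangentSpace I m := e.localFrame b
  set O₁ := O ∩ e.baseSet
  have hO₁ : IsOpen O₁ := hO.inter e.open_baseSet
  have hp₁ : p ∈ O₁ := ⟨hp, FiberBundle.mem_baseSet_trivializationAt' p⟩
  have hX : ∀ a, ContMDiffOn I I.tangent ∞ (fun m ↦ (⟨m, X a m⟩ : TangentBundle I M)) O₁ :=
    fun a ↦ (e.contMDiffOn_localFrame_baseSet ∞ b a).mono inter_subset_right
  set A : M → Matrix (Fin n) (Fin n) ℝ := fun m ↦ Matrix.of fun a c ↦ frameDeriv (X c) (t a) m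
  have hA : ∀ a c, ContMDiffOn I 𝓘(ℝ, ℝ) ∞ (fun m ↦ A m a c) O₁ := fun a c ↦
    contMDiffOn_frameDeriv hO₁ (hX c) ((ht a).mono inter_subset_left)
  have hmul : ∀ m, ∀ c : Fin n → ℝ, ∀ a,
      differential I (t a) m (∑ k, c k • X k m) = (A m).mulVec c a := by
    intro m c a
    simp only [map_sum, map_smul, Matrix.mulVec, dotProduct, smul_eq_mul]
    exact Finset.sum_congr rfl fun k _ ↦ mul_comm _ _
  have hdetp : (A p).det ≠ 0 := by
    intro h0
    obtain ⟨c, hc, hc0⟩ := Matrix.exists_mulVec_eq_zero_iff.2 h0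
    have h1 : ∑ k, c k • X k p = 0 := hinj _ fun a ↦ by rw [hmul, hc0]; rfl
    apply hc
    have h2 := Fintype.linearIndependent_iff.1 (e.basisAt b hp₁.2).linearIndependent c
      (by simpa [X, hp₁.2] using h1)
    exact funext h2
  have hdet := contMDiffOn_matrix_det hA
  set O₂ := O₁ ∩ (fun m ↦ (A m).det) ⁻¹' {0}ᶜ
  have hO₂ : IsOpen O₂ := hdet.continuousOn.isOpen_inter_preimage hO₁ isOpen_compl_singleton
  have hdet₂ : ∀ m ∈ O₂, (A m).det ≠ 0 := fun m hm ↦ hm.2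
  have hinv := contMDiffOn_matrix_inv (fun a c ↦ (hA a c).mono (inter_subset_left : O₂ ⊆ O₁)) hdet₂
  refine ⟨fun a m ↦ ∑ k, (A m)⁻¹ k a • X k m, O₂, hO₂, ⟨hp₁, hdetp⟩,
    inter_subset_left.trans inter_subset_left, ?_, ?_, ?_⟩
  · intro a
    exact ContMDiffOn.sum_section fun k _ ↦
      (hinv k a).smul_section ((hX k).mono inter_subset_left)
  · intro m hm a c
    have h1 := hmul m (fun k ↦ (A m)⁻¹ k a) c
    have h2 : A m * (A m)⁻¹ = 1 := Matrix.mul_nonsing_inv _ (isUnit_iff_ne_zero.2 hm.2)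
    have h3 := congrFun (congrFun h2 c) a
    rw [Matrix.one_apply] at h3
    exact h1.trans h3
  · intro m hm v hv
    set c := (e.basisAt b hm.1.2).repr v
    have h1 : v = ∑ k, c k • X k m :=
      ((e.basisAt b hm.1.2).sum_repr v).symm.trans
        (Finset.sum_congr rfl fun k _ ↦ by simp [X, c, hm.1.2])
    have h2 : (A m).mulVec c = 0 := funext fun a ↦ by rw [← hmul, ← h1, hv]; rfl
    have h3 : (c : Fin n → ℝ) = 0 := by
      by_contra hne
      exact hm.2 (Matrix.exists_mulVec_eq_zero_iff.1 ⟨c, hne, h2⟩)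
    rw [h1]
    simp [h3]

/-- A parametrisation is adapted to a dual frame when the coordinate functions restrict to
coordinates. -/
theorem IsDualFrame.isAdapted [IsManifold I ∞ M] {t : Fin n → M → ℝ}
    {fr : Fin n → ∀ m : M, TangentSpace I m}
    {O : Set M} (h : IsDualFrame t fr O) (hO : IsOpen O) (ht : ∀ a, ContMDiffOn I 𝓘(ℝ, ℝ) ∞ (t a) O)
    {k : ℕ} (τ : Fin k → Fin n)
    {σ : EuclideanSpace ℝ (Fin k) → M} {U : Set (EuclideanSpace ℝ (Fin k))} (hU : IsOpen U)
    (hσU : MapsTo σ U O) (hσ : ∀ z ∈ U, MDifferentiableAt (𝓡 k) I σ z)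
    (hcoord : ∀ z ∈ U, ∀ a b, partialDeriv a (fun y ↦ t b (σ y)) z = if b = τ a then 1 else 0) :
    IsAdapted (fun a ↦ fr (τ a)) σ U O := by
  refine ⟨hU, hσU, hσ, fun z hz a ↦ h.eq_fr (hσU hz) fun b ↦ ?_⟩
  rw [← hcoord z hz a b]
  have h1 : MDifferentiableAt I 𝓘(ℝ, ℝ) (t b) (σ z) :=
    ((ht b).contMDiffAt (hO.mem_nhds (hσU hz))).mdifferentiableAt (by simp)
  have := mfderiv_comp z h1 (hσ z hz)
  rw [partialDeriv, ← mfderiv_eq_fderiv]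
  change _ = mfderiv _ _ (t b ∘ σ) z _
  rw [this]
  rfl

end DualFrame

/-! ### Charts from coordinate functions -/

/-- The inverse function theorem, read in a chart. The vacuum equation is stated in charts of the
maximal atlas, so the functions (Ω, x^i) have to become one near interior points. -/
theorem exists_mem_maximalAtlas_of_mfderiv_injective {n : ℕ} {X : Type*} [TopologicalSpace X]
    [ChartedSpace (EuclideanSpace ℝ (Fin n)) X] [IsManifold (𝓡 n) ∞ X]
    {f : X → EuclideanSpace ℝ (Fin n)} {W : Set X} (hW : IsOpen W)
    (hf : ContMDiffOn (𝓡 n) (𝓡 n) ∞ f W) {x : X} (hx : x ∈ W)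
    (hinj : Function.Injective (mfderiv (𝓡 n) (𝓡 n) f x)) :
    ∃ e ∈ IsManifold.maximalAtlas (𝓡 n) ∞ X, x ∈ e.source ∧ e.source ⊆ W ∧ EqOn e f e.source := by
  set c := chartAt (EuclideanSpace ℝ (Fin n)) x
  have hc : c ∈ IsManifold.maximalAtlas (𝓡 n) ∞ X := IsManifold.chart_mem_maximalAtlas x
  have hxc : x ∈ c.source := mem_chart_source _ x
  set T := c.target ∩ c.symm ⁻¹' W
  have hT : IsOpen T := c.symm.isOpen_inter_preimage hW
  have hxT : c x ∈ T := ⟨c.map_source hxc, by simpa [hxc] using hx⟩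
  set F := f ∘ c.symm
  have hF : ContDiffOn ℝ ∞ F T := by
    rw [← contMDiffOn_iff_contDiffOn]
    exact hf.comp ((contMDiffOn_symm_of_mem_maximalAtlas hc).mono inter_subset_left)
      (fun z hz ↦ hz.2)
  have hFat : ∀ z ∈ T, ContDiffAt ℝ ∞ F z := fun z hz ↦ hF.contDiffAt (hT.mem_nhds hz)
  have hinj' : Function.Injective (fderiv ℝ F (c x)) := by
    have hcs : MDifferentiableAt (𝓡 n) (𝓡 n) c.symm (c x) :=
      (mdifferentiable_chart (I := 𝓡 n) x).mdifferentiableAt_symm (c.map_source hxc)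
    have hcx : c.symm (c x) = x := c.left_inv hxc
    have hfx : MDifferentiableAt (𝓡 n) (𝓡 n) f (c.symm (c x)) := by
      rw [hcx]
      exact (hf.contMDiffAt (hW.mem_nhds hx)).mdifferentiableAt (by simp)
    have h1 := mfderiv_comp (c x) hfx hcs
    rw [mfderiv_eq_fderiv] at h1
    change fderiv ℝ F (c x) = _ at h1
    rw [h1]
    have h2 := (mdifferentiable_chart (I := 𝓡 n) x).symm.mfderiv_injective (c.map_source hxc)
    have h3 : Function.Injective (mfderiv (𝓡 n) (𝓡 n) f (c.symm (c x))) := by rwa [hcx]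
    exact h3.comp h2
  obtain ⟨F', hF'⟩ : ∃ F' : EuclideanSpace ℝ (Fin n) ≃L[ℝ] EuclideanSpace ℝ (Fin n),
      (F' : EuclideanSpace ℝ (Fin n) →L[ℝ] EuclideanSpace ℝ (Fin n)) = fderiv ℝ F (c x) :=
    ⟨(LinearEquiv.ofInjectiveEndo _ hinj').toContinuousLinearEquiv, by ext; rfl⟩
  have hFx : HasFDerivAt F (F' : EuclideanSpace ℝ (Fin n) →L[ℝ] EuclideanSpace ℝ (Fin n)) (c x) := by
    rw [hF']
    exact ((hFat _ hxT).differentiableAt (by simp)).hasFDerivAt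
  set θ := (hFat _ hxT).toOpenPartialHomeomorph F hFx (by simp)
  have hxθ : c x ∈ θ.source := (hFat _ hxT).mem_toOpenPartialHomeomorph_source hFx (by simp)
  have hcont : ContinuousOn (fderiv ℝ F) T := hF.continuousOn_fderiv_of_isOpen hT (by simp)
  -- Restricting to the open set where the derivative is invertible makes the inverse smooth on the
  -- whole target, not only near the image of x.
  set T' := T ∩ fderiv ℝ F ⁻¹' range ((↑) : (EuclideanSpace ℝ (Fin n) ≃L[ℝ] EuclideanSpace ℝ (Fin n)) →
    EuclideanSpace ℝ (Fin n) →L[ℝ] EuclideanSpace ℝ (Fin n))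
  have hT' : IsOpen T' := hcont.isOpen_inter_preimage hT (ContinuousLinearEquiv.isOpen)
  have hxT' : c x ∈ T' := ⟨hxT, F', hF'⟩
  set θ' := θ.restrOpen T' hT'
  have hθ' : ContMDiffOn (𝓡 n) (𝓡 n) ∞ θ' θ'.source :=
    (contMDiffOn_iff_contDiffOn.2 hF).mono fun z hz ↦ hz.2.1
  have hθ'symm : ContMDiffOn (𝓡 n) (𝓡 n) ∞ θ'.symm θ'.target := by
    rw [contMDiffOn_iff_contDiffOn]
    intro z hz
    have hz' : θ'.symm z ∈ θ'.source := θ'.symm.map_source hz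
    obtain ⟨L, hL⟩ := hz'.2.2
    refine (θ'.contDiffAt_symm hz (f₀' := L) ?_ (hFat _ hz'.2.1)).contDiffWithinAt
    rw [hL]
    exact ((hFat _ hz'.2.1).differentiableAt (by simp)).hasFDerivAt
  refine ⟨c.trans θ', OpenPartialHomeomorph.mem_maximalAtlas_of_contMDiffOn _ ?_ ?_, ?_, ?_, ?_⟩
  · exact hθ'.comp ((contMDiffOn_of_mem_maximalAtlas hc).mono (by simp))
      (fun y hy ↦ by simpa using hy.2)
  · exact (contMDiffOn_symm_of_mem_maximalAtlas hc).comp (hθ'symm.mono fun y hy ↦ hy.1)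
      (fun y hy ↦ hy.2)
  · exact ⟨hxc, hxθ, hxT'⟩
  · rintro y ⟨hy, hy'⟩
    have : c.symm (c y) ∈ W := hy'.2.1.2
    rwa [c.left_inv hy] at this
  · rintro y ⟨hy, hy'⟩
    change f (c.symm (c y)) = f y
    rw [c.left_inv hy]

/-! ### Lorentzian scalar products -/

section Lorentzian

variable {n : ℕ} {V : Type*} [AddCommGroup V] [Module ℝ V] [TopologicalSpace V]
  {b : V →L[ℝ] V →L[ℝ] ℝ}

theorem IsLorentzian.symm (h : IsLorentzian n b) (u v : V) : b u v = b v u := by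
  obtain ⟨e, he⟩ := h
  rw [← e.sum_repr u, ← e.sum_repr v]
  simp only [map_sum, map_smul, sum_apply, smul_apply, he,
    smul_eq_mul, Finset.mul_sum]
  rw [Finset.sum_comm]
  refine Finset.sum_congr rfl fun i _ ↦ Finset.sum_congr rfl fun j _ ↦ ?_
  by_cases hij : i = j
  · subst hij; ring
  · simp [hij, Ne.symm hij]

theorem IsLorentzian.eq_zero (h : IsLorentzian n b) {u : V} (hu : ∀ v, b u v = 0) : u = 0 := by
  obtain ⟨e, he⟩ := h
  rw [← e.sum_repr u]
  refine Finset.sum_eq_zero fun i _ ↦ ?_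
  have h1 := hu (e i)
  rw [← e.sum_repr u] at h1
  simp only [map_sum, map_smul, sum_apply, smul_apply, he,
    smul_eq_mul] at h1
  rw [Finset.sum_eq_single i (fun j _ hj ↦ by simp [hj]) (by simp)] at h1
  have h2 : (if (i : ℕ) = 0 then (1 : ℝ) else -1) ≠ 0 := by split_ifs <;> norm_num
  rw [if_pos rfl] at h1
  rw [(mul_eq_zero.1 h1).resolve_right h2, zero_smul]

/-- A kernel vector of the Gram matrix is a combination of the f i orthogonal to their span, that is
to everything; nondegeneracy and independence make it trivial. -/
theorem IsLorentzian.det_gram_ne_zero (h : IsLorentzian n b) {ν : Type*} [Fintype ν]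
    [DecidableEq ν] {f : ν → V} (hli : LinearIndependent ℝ f)
    (hsp : ⊤ ≤ Submodule.span ℝ (range f)) :
    (Matrix.of fun i j ↦ b (f i) (f j)).det ≠ 0 := by
  intro h0
  obtain ⟨c, hc, hc0⟩ := Matrix.exists_mulVec_eq_zero_iff.2 h0
  apply hc
  refine funext (Fintype.linearIndependent_iff.1 hli c (h.eq_zero fun v ↦ ?_))
  rw [h.symm]
  have hv : v ∈ Submodule.span ℝ (range f) := hsp trivial
  induction hv using Submodule.span_induction with
  | mem x hx =>
    obtain ⟨i, rfl⟩ := hx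
    have := congrFun hc0 i
    simp only [Matrix.mulVec, dotProduct, Matrix.of_apply, Pi.zero_apply] at this
    rw [← this]
    simp [map_sum, mul_comm]
  | zero => simp
  | add x y _ _ hx hy => rw [map_add, add_apply, hx, hy, add_zero]
  | smul a x _ hx => rw [map_smul, smul_apply, hx, smul_zero]

end Lorentzian

/-! ### Manifolds with boundary -/

section Boundary

variable {E : Type*} [NormedAddCommGroup E] [NormedSpace ℝ E]
  {K : Type*} [TopologicalSpace K] {I : ModelWithCorners ℝ E K}
  {M : Type*} [TopologicalSpace M] [ChartedSpace K M]

/-- The target of an extended chart lies in the closure of its interior, whose points correspond to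
interior points of M. -/
theorem dense_interior [FiniteDimensional ℝ E] [IsManifold I 1 M] (p : M) :
    p ∈ closure (I.interior M) := by
  rw [mem_closure_iff_nhds]
  intro W hW
  have h1 : (extChartAt I p).symm ⁻¹' W ∈ 𝓝 (extChartAt I p p) :=
    (continuousAt_extChartAt_symm p).preimage_mem_nhds (by simpa using hW)
  obtain ⟨z, hzW, hz⟩ := mem_closure_iff_nhds.1
    (extChartAt_target_subset_closure_interior (mem_extChartAt_target (I := I) p)) _ h1
  refine ⟨(extChartAt I p).symm z, hzW, ?_⟩
  have hzt := interior_subset hz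
  have hsrc : (extChartAt I p).symm z ∈ (chartAt K p).source := by
    simpa using (extChartAt I p).map_target hzt
  refine (I.isInteriorPoint_iff_of_mem_atlas one_ne_zero (chart_mem_atlas K p) hsrc).2 ?_
  have h2 : (chartAt K p).extend I ((extChartAt I p).symm z) = z := (extChartAt I p).right_inv hzt
  rw [h2]
  exact hz

theorem IsSmoothBilinField.contMDiffOn_apply [IsManifold I ∞ M] {b : BilinField I M}
    (hb : IsSmoothBilinField I b) {X Y : ∀ m : M, TangentSpace I m} {O : Set M}
    (hX : ContMDiffOn I I.tangent ∞ (fun m ↦ (⟨m, X m⟩ : TangentBundle I M)) O)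
    (hY : ContMDiffOn I I.tangent ∞ (fun m ↦ (⟨m, Y m⟩ : TangentBundle I M)) O) :
    ContMDiffOn I 𝓘(ℝ, ℝ) ∞ (fun m ↦ b m (X m) (Y m)) O := by
  intro m hm
  have : ContMDiffWithinAt I (I.prod 𝓘(ℝ)) ∞
      (fun m ↦ Bundle.TotalSpace.mk' ℝ (E := Bundle.Trivial M ℝ) m (b m (X m) (Y m))) O m := by
    apply ContMDiffWithinAt.clm_bundle_apply₂ (F₁ := E) (F₂ := E)
    · exact hb.contMDiffAt.contMDiffWithinAt
    · exact hX m hm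
    · exact hY m hm
  simp only [Bundle.contMDiffWithinAt_totalSpace] at this
  exact this.2

variable {n : ℕ} {H : Type*} [TopologicalSpace H] [ChartedSpace (EuclideanSpace ℝ (Fin n)) H]

/-- A chart of an immersed manifold extends to a smooth function on the ambient manifold. -/
theorem exists_contMDiffOn_comp_eq_chart {ι : H → M} {p : H}
    (hι : IsImmersionAt (𝓡 n) I ∞ ι p) {e : OpenPartialHomeomorph H (EuclideanSpace ℝ (Fin n))}
    [IsManifold (𝓡 n) ∞ H]
    (he : e ∈ IsManifold.maximalAtlas (𝓡 n) ∞ H) (hp : p ∈ e.source) :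
    ∃ (O : Set M) (π : M → EuclideanSpace ℝ (Fin n)), IsOpen O ∧ ι p ∈ O ∧
      ContMDiffOn I (𝓡 n) ∞ π O ∧ ∀ᶠ x in 𝓝 p, π (ι x) = e x := by
  set d := hι.domChart
  set c := hι.codChart
  -- In the charts of the immersion ι is x ↦ (x, 0), so the first component recovers x; the change
  -- of chart from d to e is applied afterwards.
  set P : M → EuclideanSpace ℝ (Fin n) := fun m ↦ (hι.equiv.symm (c.extend I m)).1
  have hP : ContMDiffOn I (𝓡 n) ∞ P c.source := by
    have h1 : ContMDiff 𝓘(ℝ, E) (𝓡 n) ∞ (fun y : E ↦ (hι.equiv.symm y).1) :=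
      contMDiff_iff_contDiff.2 (contDiff_fst.comp hι.equiv.symm.contDiff)
    exact h1.comp_contMDiffOn (c.contMDiffOn_extend hι.codChart_mem_maximalAtlas)
  have hPι : ∀ x ∈ d.source, P (ι x) = d x := by
    intro x hx
    have hx' : d.extend (𝓡 n) x ∈ (d.extend (𝓡 n)).target := by simpa using d.map_source hx
    have h1 := hι.writtenInCharts hx'
    simp only [Function.comp_apply] at h1
    have h2 : (d.extend (𝓡 n)).symm (d.extend (𝓡 n) x) = x := d.extend_left_inv hx
    rw [h2] at h1
    simp only [P, c, h1]
    simp [d]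
  have hD : IsOpen (d.target ∩ d.symm ⁻¹' e.source) := d.symm.isOpen_inter_preimage e.open_source
  have hO : IsOpen (c.source ∩ P ⁻¹' (d.target ∩ d.symm ⁻¹' e.source)) :=
    hP.continuousOn.isOpen_inter_preimage c.open_source hD
  have hpd := hι.mem_domChart_source
  refine ⟨_, fun m ↦ e (d.symm (P m)), hO, ⟨hι.mem_codChart_source, ?_⟩, ?_, ?_⟩
  · rw [mem_preimage, hPι p hpd]
    exact ⟨d.map_source hpd, by simpa [d, d.left_inv hpd] using hp⟩
  · exact (contMDiffOn_of_mem_maximalAtlas he).comp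
      ((contMDiffOn_symm_of_mem_maximalAtlas hι.domChart_mem_maximalAtlas).comp
        (hP.mono inter_subset_left) fun m hm ↦ hm.2.1) fun m hm ↦ hm.2.2
  · filter_upwards [d.open_source.mem_nhds hpd] with x hx
    rw [hPι x hx, d.left_inv hx]

end Boundary

theorem partialDeriv_coord {n : ℕ} (a b : Fin n) (z : EuclideanSpace ℝ (Fin n)) :
    partialDeriv a (fun y ↦ y b) z = if b = a then 1 else 0 := by
  have : HasFDerivAt (fun y : EuclideanSpace ℝ (Fin n) ↦ y b)
      (EuclideanSpace.proj b : EuclideanSpace ℝ (Fin n) →L[ℝ] ℝ) z :=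
    (EuclideanSpace.proj b : EuclideanSpace ℝ (Fin n) →L[ℝ] ℝ).hasFDerivAt
  rw [partialDeriv, this.fderiv]
  simp

/-! ### The spacetime as the interior of the manifold with boundary -/

section Interior

variable {X M : Type*}
  [TopologicalSpace X] [ChartedSpace (EuclideanSpace ℝ (Fin 4)) X]
  [TopologicalSpace M] [ChartedSpace (EuclideanHalfSpace 4) M] [IsManifold (𝓡∂ 4) ∞ M]

theorem contMDiff_coe_diffeomorph (Φ : X ≃ₘ^∞⟮𝓡 4, 𝓡∂ 4⟯ (interiorOpens M)) :
    ContMDiff (𝓡 4) (𝓡∂ 4) ∞ (fun x : X ↦ (Φ x : M)) :=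
  contMDiff_subtype_val.comp Φ.contMDiff

theorem mdifferentiableAt_coe_diffeomorph (Φ : X ≃ₘ^∞⟮𝓡 4, 𝓡∂ 4⟯ (interiorOpens M)) (x : X) :
    MDifferentiableAt (𝓡 4) (𝓡∂ 4) (fun x : X ↦ (Φ x : M)) x :=
  (contMDiff_coe_diffeomorph Φ).mdifferentiableAt (by simp)

theorem differential_comp_coe {Φ : X ≃ₘ^∞⟮𝓡 4, 𝓡∂ 4⟯ (interiorOpens M)} {f : M → ℝ} {x : X}
    (hf : MDifferentiableAt (𝓡∂ 4) 𝓘(ℝ, ℝ) f (Φ x)) (u : TangentSpace (𝓡 4) x) :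
    differential (𝓡 4) (fun x : X ↦ f (Φ x)) x u
      = differential (𝓡∂ 4) f (Φ x) (mfderiv (𝓡 4) (𝓡∂ 4) (fun x : X ↦ (Φ x : M)) x u) := by
  have := mfderiv_comp x hf (mdifferentiableAt_coe_diffeomorph Φ x)
  simp only [differential]
  change mfderiv _ _ (f ∘ fun x : X ↦ (Φ x : M)) x u = _
  rw [this]
  rfl

theorem mem_closure_range_diffeomorph (Φ : X ≃ₘ^∞⟮𝓡 4, 𝓡∂ 4⟯ (interiorOpens M)) (p : M) :
    p ∈ closure (range fun x : X ↦ (Φ x : M)) := by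
  have h1 : (range fun x : X ↦ (Φ x : M)) = (𝓡∂ 4).interior M := by
    ext m
    refine ⟨?_, fun hm ↦ ?_⟩
    · rintro ⟨x, rfl⟩
      exact (Φ x).2
    · obtain ⟨x, hx⟩ := Φ.surjective ⟨m, hm⟩
      exact ⟨x, congrArg Subtype.val hx⟩
  rw [h1]
  exact dense_interior p

end Interior

/-! ### Asymptotes in an adapted frame -/

section Asymptote

variable {X M H : Type*}
  [TopologicalSpace X] [ChartedSpace (EuclideanSpace ℝ (Fin 4)) X] [IsManifold (𝓡 4) ∞ X]
  [TopologicalSpace M] [ChartedSpace (EuclideanHalfSpace 4) M] [IsManifold (𝓡∂ 4) ∞ M]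
  [TopologicalSpace H] [ChartedSpace (EuclideanSpace ℝ (Fin 3)) H] [IsManifold (𝓡 3) ∞ H]
  {g : BilinField (𝓡 4) X} {Φ : X ≃ₘ^∞⟮𝓡 4, 𝓡∂ 4⟯ (interiorOpens M)} {ι : H → M}
  {Ω : M → ℝ} {q : BilinField (𝓡∂ 4) M} {N : ∀ p : M, TangentSpace (𝓡∂ 4) p}
  {t : Fin 4 → M → ℝ} {fr : Fin 4 → ∀ m : M, TangentSpace (𝓡∂ 4) m} {O : Set M}

/-- The components of `q` and `N` in the frame `fr`. -/
def adaptedFields (t : Fin 4 → M → ℝ) (fr : Fin 4 → ∀ m : M, TangentSpace (𝓡∂ 4) m)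
    (q : BilinField (𝓡∂ 4) M) (N : ∀ p : M, TangentSpace (𝓡∂ 4) p) : FrameFields (𝓡∂ 4) M where
  fr := fr
  w := t 0
  q m := Matrix.of fun a b ↦ q m (fr a m) (fr b m)
  N m a := differential (𝓡∂ 4) (t a) m (N m)
  h m := (Matrix.of fun i j : Fin 3 ↦ q m (fr i.succ m) (fr j.succ m))⁻¹

theorem adaptedFields_isSmoothOn (hq : IsSmoothBilinField (𝓡∂ 4) q)
    (hN : IsSmoothVectorField (𝓡∂ 4) N) (hO : IsOpen O) (hD : IsDualFrame t fr O)
    (ht : ∀ a, ContMDiffOn (𝓡∂ 4) 𝓘(ℝ, ℝ) ∞ (t a) O)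
    (hdet : ∀ m ∈ O, (Matrix.of fun i j : Fin 3 ↦ q m (fr i.succ m) (fr j.succ m)).det ≠ 0) :
    (adaptedFields t fr q N).IsSmoothOn O where
  fr := hD.contMDiffOn
  w := ht 0
  q a b := hq.contMDiffOn_apply (hD.contMDiffOn a) (hD.contMDiffOn b)
  N a := contMDiffOn_frameDeriv hO (ContMDiff.contMDiffOn hN) (ht a)
  h := contMDiffOn_matrix_inv
    (fun i j ↦ hq.contMDiffOn_apply (hD.contMDiffOn i.succ) (hD.contMDiffOn j.succ)) hdet

namespace IsAsymptote

theorem mdifferentiableAt_Ω (h : IsAsymptote g Φ ι Ω q N) (m : M) :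
    MDifferentiableAt (𝓡∂ 4) 𝓘(ℝ, ℝ) Ω m :=
  h.Ω_smooth.mdifferentiableAt (by simp)

theorem q_mfderiv (h : IsAsymptote g Φ ι Ω q N) (x : X) (u v : TangentSpace (𝓡 4) x) :
    q (Φ x) (mfderiv (𝓡 4) (𝓡∂ 4) (fun x : X ↦ (Φ x : M)) x u)
        (mfderiv (𝓡 4) (𝓡∂ 4) (fun x : X ↦ (Φ x : M)) x v)
      = Ω (Φ x) ^ 2 * (g x u v + (Ω (Φ x) ^ 4)⁻¹ *
        (differential (𝓡∂ 4) Ω (Φ x) (mfderiv (𝓡 4) (𝓡∂ 4) (fun x : X ↦ (Φ x : M)) x u) *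
          differential (𝓡∂ 4) Ω (Φ x)
            (mfderiv (𝓡 4) (𝓡∂ 4) (fun x : X ↦ (Φ x : M)) x v))) := by
  have := h.q_eq x u v
  rwa [pullback_apply, differential_comp_coe (h.mdifferentiableAt_Ω _),
    differential_comp_coe (h.mdifferentiableAt_Ω _)] at this

/-- If the differential kills u, the relation between q and g leaves Ω² g(u, v) = 0 for every v, and
g is nondegenerate. -/
theorem mfderiv_coe_injective (h : IsAsymptote g Φ ι Ω q N) (x : X) :
    Function.Injective (mfderiv (𝓡 4) (𝓡∂ 4) (fun x : X ↦ (Φ x : M)) x) := by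
  rw [injective_iff_map_eq_zero]
  intro u hu
  refine (h.vacuum.lorentzian x).eq_zero fun v ↦ ?_
  have h1 := h.q_mfderiv x u v
  rw [hu] at h1
  simp only [map_zero, zero_mul, mul_zero, add_zero] at h1
  exact (mul_eq_zero.1 h1.symm).resolve_left (pow_ne_zero 2 (h.Ω_ne_zero x))

theorem mfderiv_coe_surjective (h : IsAsymptote g Φ ι Ω q N) (x : X) :
    Function.Surjective (mfderiv (𝓡 4) (𝓡∂ 4) (fun x : X ↦ (Φ x : M)) x) := by
  let L : EuclideanSpace ℝ (Fin 4) →ₗ[ℝ] EuclideanSpace ℝ (Fin 4) :=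
    (mfderiv (𝓡 4) (𝓡∂ 4) (fun x : X ↦ (Φ x : M)) x).toLinearMap
  exact (LinearMap.injective_iff_surjective (f := L)).1 (h.mfderiv_coe_injective x)

theorem q_symm (h : IsAsymptote g Φ ι Ω q N) (x : X) (u v : TangentSpace (𝓡∂ 4) (Φ x : M)) :
    q (Φ x) u v = q (Φ x) v u := by
  obtain ⟨u, rfl⟩ := h.mfderiv_coe_surjective x u
  obtain ⟨v, rfl⟩ := h.mfderiv_coe_surjective x v
  rw [h.q_mfderiv, h.q_mfderiv, (h.vacuum.lorentzian x).symm u v]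
  ring

/-- `q(v, N) = Ω⁻² (1 + F) dΩ(v)` in the interior. -/
theorem q_normal (h : IsAsymptote g Φ ι Ω q N) (x : X) (v : TangentSpace (𝓡∂ 4) (Φ x : M)) :
    q (Φ x) v (N (Φ x)) = (Ω (Φ x) ^ 2)⁻¹ * (1 + differential (𝓡∂ 4) Ω (Φ x) (N (Φ x)))
      * differential (𝓡∂ 4) Ω (Φ x) v := by
  obtain ⟨v, rfl⟩ := h.mfderiv_coe_surjective x v
  obtain ⟨w, hw, hN⟩ := h.N_eq x
  have h0 := h.Ω_ne_zero x
  -- With N the image of w, the two summands are g(v, w) = Ω⁻⁴ dΩ(v) and Ω⁻⁴ F dΩ(v).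
  rw [hN, h.q_mfderiv, (h.vacuum.lorentzian x).symm, hw,
    differential_comp_coe (h.mdifferentiableAt_Ω _)]
  field_simp

/-- Both relations for N are `q_normal` evaluated on the frame, where dΩ(fr a) is 1 for a = 0 and 0
otherwise. -/
theorem isInterior_jet (h : IsAsymptote g Φ ι Ω q N) (hD : IsDualFrame t fr O) (ht : t 0 = Ω)
    (hdet : ∀ m ∈ O, (Matrix.of fun i j : Fin 3 ↦ q m (fr i.succ m) (fr j.succ m)).det ≠ 0)
    {x : X} (hx : (Φ x : M) ∈ O) :
    ((adaptedFields t fr q N).jet (Φ x)).IsInterior := by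
  have h0 : Ω (Φ x) ≠ 0 := h.Ω_ne_zero x
  have hsum : ∀ a, ∑ c, q (Φ x) (fr a (Φ x)) (fr c (Φ x)) *
      differential (𝓡∂ 4) (t c) (Φ x) (N (Φ x))
      = (Ω (Φ x) ^ 2)⁻¹ * (1 + differential (𝓡∂ 4) Ω (Φ x) (N (Φ x))) * if 0 = a then 1 else 0 := by
    intro a
    have h1 : differential (𝓡∂ 4) Ω (Φ x) (fr a (Φ x)) = if 0 = a then 1 else 0 :=
      ht ▸ hD.frameDeriv_eq _ hx a 0
    rw [← h1, ← h.q_normal]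
    conv_rhs => rw [hD.eq_sum hx (N (Φ x))]
    simp [map_sum, mul_comm]
  refine ⟨?_, ?_, ?_, ?_, ?_, ?_⟩
  · simpa [FrameFields.jet, adaptedFields, ht] using h0
  · exact fun a b ↦ h.q_symm x _ _
  · intro a b c
    refine frameDeriv_congr ?_
    filter_upwards [(interiorOpens M).isOpen.mem_nhds (Φ x).2] with m hm
    obtain ⟨y, hy⟩ := Φ.surjective ⟨m, hm⟩
    have hy' : (Φ y : M) = m := congrArg Subtype.val hy
    subst hy'
    exact h.q_symm y _ _
  · intro i j
    have h2 := Matrix.nonsing_inv_mul _ (isUnit_iff_ne_zero.2 (hdet _ hx))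
    have h3 := congrFun (congrFun h2 i) j
    rw [Matrix.one_apply] at h3
    exact h3
  · intro i
    refine (hsum i.succ).trans ?_
    simp [(Fin.succ_ne_zero i).symm]
  · have h4 : ((adaptedFields t fr q N).jet (Φ x)).normalPart
        = (Ω (Φ x) ^ 2)⁻¹ * (1 + differential (𝓡∂ 4) Ω (Φ x) (N (Φ x))) :=
      (hsum 0).trans (by simp)
    rw [h4]
    simp only [FrameFields.jet, adaptedFields, ht]
    field_simp
    ring

/-- The vacuum equation in an adapted frame. -/
theorem limitRicci_eq_zero (h : IsAsymptote g Φ ι Ω q N) (hO : IsOpen O) (hD : IsDualFrame t fr O)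
    (ht : ∀ a, ContMDiffOn (𝓡∂ 4) 𝓘(ℝ, ℝ) ∞ (t a) O) (ht0 : t 0 = Ω)
    (hdet : ∀ m ∈ O, (Matrix.of fun i j : Fin 3 ↦ q m (fr i.succ m) (fr j.succ m)).det ≠ 0)
    {x : X} (hx : (Φ x : M) ∈ O) (i j : Fin 3) :
    (adaptedFields t fr q N).limitRicci i j (Φ x) = 0 := by
  set Ψ : X → M := fun x ↦ (Φ x : M)
  have hΨ : ContMDiff (𝓡 4) (𝓡∂ 4) ∞ Ψ := contMDiff_coe_diffeomorph Φ
  -- The coordinate functions pulled back to the spacetime. In the chart they form near x, the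
  -- coordinate vectors are the frame and the components of g are `phys`.
  set f : X → EuclideanSpace ℝ (Fin 4) := fun y ↦ WithLp.toLp 2 fun a ↦ t a (Ψ y)
  have hW : IsOpen (Ψ ⁻¹' O) := hO.preimage hΨ.continuous
  have hf : ContMDiffOn (𝓡 4) (𝓡 4) ∞ f (Ψ ⁻¹' O) := by
    have h1 : ContMDiffOn (𝓡 4) 𝓘(ℝ, Fin 4 → ℝ) ∞ (fun y a ↦ t a (Ψ y)) (Ψ ⁻¹' O) :=
      contMDiffOn_pi_space.2 fun a ↦ (ht a).comp hΨ.contMDiffOn fun y hy ↦ hy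
    exact (contMDiff_iff_contDiff.2
      (EuclideanSpace.equiv (Fin 4) ℝ).symm.contDiff).comp_contMDiffOn h1
  have hinj : Function.Injective (mfderiv (𝓡 4) (𝓡 4) f x) := by
    rw [injective_iff_map_eq_zero]
    intro u hu
    refine (injective_iff_map_eq_zero _).1 (h.mfderiv_coe_injective x) u
      (hD.eq_zero _ hx _ fun b ↦ ?_)
    have hfx : MDifferentiableAt (𝓡 4) (𝓡 4) f x :=
      (hf.contMDiffAt (hW.mem_nhds hx)).mdifferentiableAt (by simp)
    rw [← differential_comp_coe
      (((ht b).contMDiffAt (hO.mem_nhds hx)).mdifferentiableAt (by simp))]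
    have hpr : MDifferentiableAt (𝓡 4) 𝓘(ℝ, ℝ)
        (EuclideanSpace.proj b : EuclideanSpace ℝ (Fin 4) →L[ℝ] ℝ) (f x) :=
      (EuclideanSpace.proj b : EuclideanSpace ℝ (Fin 4) →L[ℝ] ℝ).mdifferentiableAt
    have h1 := mfderiv_comp x hpr hfx
    change mfderiv _ _ ((EuclideanSpace.proj b : EuclideanSpace ℝ (Fin 4) →L[ℝ] ℝ) ∘ f) x u = 0
    rw [h1, ContinuousLinearMap.comp_apply, hu, map_zero]
  obtain ⟨e, he, hxe, heW, hef⟩ :=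
    exists_mem_maximalAtlas_of_mfderiv_injective hW hf hx hinj
  set σ : EuclideanSpace ℝ (Fin 4) → M := fun z ↦ Ψ (e.symm z)
  have hes : ∀ z ∈ e.target, MDifferentiableAt (𝓡 4) (𝓡 4) e.symm z := fun z hz ↦
    (contMDiffAt_symm_of_mem_maximalAtlas he hz).mdifferentiableAt (by simp)
  have hσ : IsAdapted fr σ e.target O := by
    refine hD.isAdapted hO ht id e.open_target (fun z hz ↦ heW (e.map_target hz))
      (fun z hz ↦ (hΨ.mdifferentiableAt (by simp)).comp z (hes z hz)) fun z hz a b ↦ ?_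
    rw [id, ← partialDeriv_coord a b z]
    refine partialDeriv_congr a ?_
    filter_upwards [e.open_target.mem_nhds hz] with y hy
    have h1 := hef (e.map_target hy)
    rw [e.right_inv hy] at h1
    exact (congrArg (fun v : EuclideanSpace ℝ (Fin 4) ↦ v b) h1).symm
  have hI : ∀ z ∈ e.target, ((adaptedFields t fr q N).jet (σ z)).IsInterior := fun z hz ↦
    h.isInterior_jet hD ht0 hdet (heW (e.map_target hz))
  have hfr : ∀ m ∈ O, ∀ a, frameDeriv (fr a) (t 0) m = if a = 0 then 1 else 0 := fun m hm a ↦ by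
    rw [hD.frameDeriv_eq m hm a 0]; simp only [eq_comm]
  have hG : ∀ z ∈ e.target, components g e z = ((adaptedFields t fr q N).jet (σ z)).phys := by
    intro z hz
    ext a b
    have hd : ∀ a, mfderiv (𝓡 4) (𝓡∂ 4) Ψ (e.symm z)
        (mfderiv (𝓡 4) (𝓡 4) e.symm z (EuclideanSpace.single a 1)) = fr a (σ z) := by
      intro a
      rw [← hσ.mfderiv_single z hz a]
      have := mfderiv_comp z (hΨ.mdifferentiableAt (by simp)) (hes z hz)
      change _ = mfderiv _ _ (Ψ ∘ e.symm) z _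
      rw [this]
      rfl
    have h1 := h.q_mfderiv (e.symm z) (mfderiv (𝓡 4) (𝓡 4) e.symm z (EuclideanSpace.single a 1))
      (mfderiv (𝓡 4) (𝓡 4) e.symm z (EuclideanSpace.single b 1))
    rw [hd, hd] at h1
    have hΩ : ∀ a, differential (𝓡∂ 4) Ω (Φ (e.symm z)) (fr a (σ z)) = if a = 0 then 1 else 0 :=
      fun a ↦ ht0 ▸ hfr _ (hσ.mapsTo hz) a
    rw [hΩ, hΩ] at h1
    have h0 := h.Ω_ne_zero (e.symm z)
    simp only [AsymptoticJet.phys, FrameFields.jet, adaptedFields, Matrix.of_apply, ht0, components]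
    have hσz : σ z = (Φ (e.symm z) : M) := rfl
    rw [hσz] at h1 ⊢
    rw [h1]
    by_cases ha : a = 0 <;> by_cases hb : b = 0 <;> simp [ha, hb] <;> field_simp
    ring
  have hric := FrameFields.ricci_interior
    (adaptedFields_isSmoothOn h.q_smooth h.N_smooth hO hD ht hdet) hO hfr hσ hI hG
    (e.map_source hxe) i j
  have hvac := h.vacuum.ricci_eq_zero e he _ (e.map_source hxe) i.succ j.succ
  have hσx : σ (e x) = Φ x := by simp only [σ, Ψ, e.left_inv hxe]
  rw [hσx] at hric
  rw [← hric, hvac, zero_mul]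

end IsAsymptote

end Asymptote

/-! ### The Ricci tensor of the boundary -/

variable {X M H : Type*}
  [TopologicalSpace X] [ChartedSpace (EuclideanSpace ℝ (Fin 4)) X] [IsManifold (𝓡 4) ∞ X]
  [TopologicalSpace M] [ChartedSpace (EuclideanHalfSpace 4) M] [IsManifold (𝓡∂ 4) ∞ M]
  [TopologicalSpace H] [ChartedSpace (EuclideanSpace ℝ (Fin 3)) H] [IsManifold (𝓡 3) ∞ H]
  {g : BilinField (𝓡 4) X} {Φ : X ≃ₘ^∞⟮𝓡 4, 𝓡∂ 4⟯ (interiorOpens M)} {ι : H → M}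
  {Ω : M → ℝ} {q : BilinField (𝓡∂ 4) M} {N : ∀ p : M, TangentSpace (𝓡∂ 4) p}

/-- Coordinate functions near a boundary point: the conformal factor, and functions that restrict
to a given chart of the boundary. -/
theorem IsAsymptote.exists_coordinates (h : IsAsymptote g Φ ι Ω q N)
    {e : OpenPartialHomeomorph H (EuclideanSpace ℝ (Fin 3))}
    (he : e ∈ IsManifold.maximalAtlas (𝓡 3) ∞ H) {z : EuclideanSpace ℝ (Fin 3)}
    (hz : z ∈ e.target) :
    ∃ (t : Fin 4 → M → ℝ) (O : Set M), IsOpen O ∧ ι (e.symm z) ∈ O ∧ t 0 = Ω ∧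
      (∀ a, ContMDiffOn (𝓡∂ 4) 𝓘(ℝ, ℝ) ∞ (t a) O) ∧
      ∀ᶠ y in 𝓝 z, ∀ i : Fin 3, t i.succ (ι (e.symm y)) = y i := by
  obtain ⟨O, π, hO, hp, hπ, hev⟩ := exists_contMDiffOn_comp_eq_chart
    (h.ι_embedding.isImmersion.isImmersionAt (e.symm z)) he (e.map_target hz)
  refine ⟨Fin.cons Ω fun i m ↦ π m i, O, hO, hp, rfl, ?_, ?_⟩
  · refine Fin.cases h.Ω_smooth.contMDiffOn fun i ↦ ?_
    exact ((EuclideanSpace.proj i : EuclideanSpace ℝ (Fin 3) →L[ℝ] ℝ).contDiff.contMDiff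
      (n := ∞)).comp_contMDiffOn hπ
  · filter_upwards [(e.continuousAt_symm hz).eventually hev, e.open_target.mem_nhds hz]
      with y hy hyt i
    simp only [Fin.cons_succ, hy, e.right_inv hyt]

theorem IsAsymptote.mdifferentiableAt_ι (h : IsAsymptote g Φ ι Ω q N) (p : H) :
    MDifferentiableAt (𝓡 3) (𝓡∂ 4) ι p :=
  h.ι_embedding.contMDiff.mdifferentiableAt (by simp)

/-- The theorem at one boundary point, with F found explicitly: its constancy on ℋ then needs no
argument along ℋ. -/
theorem IsAsymptote.ricci_boundary (h : IsAsymptote g Φ ι Ω q N)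
    {e : OpenPartialHomeomorph H (EuclideanSpace ℝ (Fin 3))}
    (he : e ∈ IsManifold.maximalAtlas (𝓡 3) ∞ H) {z : EuclideanSpace ℝ (Fin 3)}
    (hz : z ∈ e.target) :
    digamma Ω N (ι (e.symm z)) = -1 ∧ ∀ i j,
      ricci (components (pullback (𝓡∂ 4) (𝓡 3) ι q) e) i j z
        = -2 * components (pullback (𝓡∂ 4) (𝓡 3) ι q) e z i j := by
  obtain ⟨t, O₁, hO₁, hp₁, ht0, ht₁, hev⟩ := h.exists_coordinates he hz
  set p := e.symm z
  set σ : EuclideanSpace ℝ (Fin 3) → M := fun y ↦ ι (e.symm y)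
  have hes : ∀ y ∈ e.target, MDifferentiableAt (𝓡 3) (𝓡 3) e.symm y := fun y hy ↦
    (contMDiffAt_symm_of_mem_maximalAtlas he hy).mdifferentiableAt (by simp)
  have hσd : ∀ y ∈ e.target, MDifferentiableAt (𝓡 3) (𝓡∂ 4) σ y := fun y hy ↦
    (h.mdifferentiableAt_ι _).comp y (hes y hy)
  have hσm : ∀ y ∈ e.target, ∀ i, mfderiv (𝓡 3) (𝓡∂ 4) σ y (EuclideanSpace.single i 1)
      = mfderiv (𝓡 3) (𝓡∂ 4) ι (e.symm y)
        (mfderiv (𝓡 3) (𝓡 3) e.symm y (EuclideanSpace.single i 1)) := by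
    intro y hy i
    have := mfderiv_comp y (h.mdifferentiableAt_ι _) (hes y hy)
    change mfderiv _ _ (ι ∘ e.symm) y _ = _
    rw [this]
    rfl
  obtain ⟨U₁, hU₁sub, hU₁, hzU₁⟩ := eventually_nhds_iff.1 hev
  have hcoord : ∀ y ∈ U₁, ∀ i b,
      partialDeriv i (fun y ↦ t b (σ y)) y = if b = i.succ then 1 else 0 := by
    intro y hy i b
    refine Fin.cases ?_ (fun k ↦ ?_) b
    · have h1 : (fun y ↦ t 0 (σ y)) = fun _ ↦ 0 := funext fun y ↦ by rw [ht0]; exact h.Ω_eq_zero _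
      rw [h1]
      simp [partialDeriv, (Fin.succ_ne_zero i).symm]
    · have h1 : (fun y ↦ t k.succ (σ y)) =ᶠ[𝓝 y] fun y ↦ y k := by
        filter_upwards [hU₁.mem_nhds hy] with x hx using hU₁sub x hx k
      rw [partialDeriv_congr i h1, partialDeriv_coord]
      simp
  have hcoord' : ∀ i b, differential (𝓡∂ 4) (t b) (ι p)
      (mfderiv (𝓡 3) (𝓡∂ 4) σ z (EuclideanSpace.single i 1)) = if b = i.succ then 1 else 0 := by
    intro i b
    have h1 : MDifferentiableAt (𝓡∂ 4) 𝓘(ℝ, ℝ) (t b) (σ z) :=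
      ((ht₁ b).contMDiffAt (hO₁.mem_nhds hp₁)).mdifferentiableAt (by simp)
    have := mfderiv_comp z h1 (hσd z hz)
    rw [← hcoord z hzU₁ i b, partialDeriv, ← mfderiv_eq_fderiv]
    change _ = mfderiv _ _ (t b ∘ σ) z _
    rw [this]
    rfl
  have hinj : ∀ v : TangentSpace (𝓡∂ 4) (ι p),
      (∀ b, differential (𝓡∂ 4) (t b) (ι p) v = 0) → v = 0 := by
    let L : EuclideanSpace ℝ (Fin 4) →ₗ[ℝ] (Fin 4 → ℝ) :=
      LinearMap.pi fun b ↦ (differential (𝓡∂ 4) (t b) (ι p)).toLinearMap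
    -- dΩ ≠ 0 supplies u with dΩ(u) = 1, and the coordinate vectors of ℋ satisfy dΩ = 0 and are dual
    -- to the dx^i. The preimage of c is c_0 u with its x-components corrected; equality of
    -- dimensions then gives injectivity.
    have hsurj : Function.Surjective L := by
      intro c
      obtain ⟨u, hu⟩ : ∃ u, differential (𝓡∂ 4) (t 0) (ι p) u = 1 := by
        obtain ⟨u, hu⟩ := ContinuousLinearMap.exists_ne_zero (h.dΩ_ne_zero p)
        refine ⟨(differential (𝓡∂ 4) Ω (ι p) u)⁻¹ • u, ?_⟩
        rw [ht0, map_smul]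
        exact inv_mul_cancel₀ hu
      refine ⟨c 0 • u + ∑ i : Fin 3, (c i.succ - c 0 * differential (𝓡∂ 4) (t i.succ) (ι p) u) •
        mfderiv (𝓡 3) (𝓡∂ 4) σ z (EuclideanSpace.single i 1), funext fun b ↦ ?_⟩
      change differential (𝓡∂ 4) (t b) (ι p) _ = c b
      erw [map_add, map_smul, map_sum]
      simp_rw [map_smul]
      erw [Finset.sum_congr rfl fun i _ ↦ by rw [hcoord' i b]]
      refine Fin.cases ?_ (fun k ↦ ?_) b
      · simp [hu, (Fin.succ_ne_zero _).symm]
      · simp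
    have hLinj : Function.Injective L :=
      (LinearMap.injective_iff_surjective_of_finrank_eq_finrank (by simp)).2 hsurj
    intro v hv
    exact (injective_iff_map_eq_zero L).1 hLinj v (funext hv)
  obtain ⟨fr, O₂, hO₂, hp₂, hO₂₁, hD₂⟩ := exists_isDualFrame hO₁ hp₁ ht₁ hinj
  set A : M → Matrix (Fin 3) (Fin 3) ℝ := fun m ↦
    Matrix.of fun i j : Fin 3 ↦ q m (fr i.succ m) (fr j.succ m)
  have hA := contMDiffOn_matrix_det (A := A) (I := 𝓡∂ 4) (O := O₂) fun i j ↦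
    h.q_smooth.contMDiffOn_apply (hD₂.contMDiffOn i.succ) (hD₂.contMDiffOn j.succ)
  have hcomp : ∀ y ∈ e.target, (∀ i : Fin 3,
      mfderiv (𝓡 3) (𝓡∂ 4) σ y (EuclideanSpace.single i 1) = fr i.succ (σ y)) →
      ∀ i j, components (pullback (𝓡∂ 4) (𝓡 3) ι q) e y i j = A (σ y) i j := by
    intro y hy hfr i j
    simp only [components, Matrix.of_apply, pullback_apply, A, ← hfr, hσm y hy]
    rfl
  have hfrp : ∀ i : Fin 3,
      mfderiv (𝓡 3) (𝓡∂ 4) σ z (EuclideanSpace.single i 1) = fr i.succ (σ z) := fun i ↦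
    hD₂.eq_fr hp₂ (hcoord' i)
  -- At p this is the Gram matrix of the boundary metric on a coordinate basis, so the signature
  -- makes it invertible; it stays invertible on the smaller neighbourhood O.
  have hdetp : (A (ι p)).det ≠ 0 := by
    have hA1 : A (ι p) = Matrix.of fun i j ↦ pullback (𝓡∂ 4) (𝓡 3) ι q p
        (mfderiv (𝓡 3) (𝓡 3) e.symm z (EuclideanSpace.single i 1))
        (mfderiv (𝓡 3) (𝓡 3) e.symm z (EuclideanSpace.single j 1)) := by
      ext i j
      exact (hcomp z hz hfrp i j).symm
    have hem : e.MDifferentiable (𝓡 3) (𝓡 3) :=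
      ⟨(contMDiffOn_of_mem_maximalAtlas he).mdifferentiableOn (by simp),
        (contMDiffOn_symm_of_mem_maximalAtlas he).mdifferentiableOn (by simp)⟩
    have hbij := hem.symm.mfderiv_bijective (x := z) hz
    let B := (EuclideanSpace.basisFun (Fin 3) ℝ).toBasis
    let L : EuclideanSpace ℝ (Fin 3) ≃ₗ[ℝ] TangentSpace (𝓡 3) p :=
      LinearEquiv.ofBijective (mfderiv (𝓡 3) (𝓡 3) e.symm z).toLinearMap hbij
    have hB : ∀ i, (B.map L) i = mfderiv (𝓡 3) (𝓡 3) e.symm z (EuclideanSpace.single i 1) := by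
      intro i
      have hBi : B i = EuclideanSpace.single i 1 := by simp [B]
      rw [Module.Basis.map_apply, hBi]
      rfl
    rw [hA1]
    simp only [← hB]
    exact (h.q_lorentzian p).det_gram_ne_zero (B.map L).linearIndependent (B.map L).span_eq.ge
  set O := O₂ ∩ (fun m ↦ (A m).det) ⁻¹' {0}ᶜ
  have hO : IsOpen O := hA.continuousOn.isOpen_inter_preimage hO₂ isOpen_compl_singleton
  have hp : ι p ∈ O := ⟨hp₂, hdetp⟩
  have hD : IsDualFrame t fr O := hD₂.mono inter_subset_left
  have ht : ∀ a, ContMDiffOn (𝓡∂ 4) 𝓘(ℝ, ℝ) ∞ (t a) O := fun a ↦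
    (ht₁ a).mono (inter_subset_left.trans hO₂₁)
  have hdet : ∀ m ∈ O, (A m).det ≠ 0 := fun m hm ↦ hm.2
  have hS := adaptedFields_isSmoothOn h.q_smooth h.N_smooth hO hD ht hdet
  set U := (e.target ∩ σ ⁻¹' O) ∩ U₁
  have hU : IsOpen U := by
    have hσc : ContinuousOn σ e.target := fun y hy ↦ (hσd y hy).continuousAt.continuousWithinAt
    exact (hσc.isOpen_inter_preimage e.open_target hO).inter hU₁
  have hzU : z ∈ U := ⟨⟨hz, hp⟩, hzU₁⟩
  have hσ : IsAdapted (fun i : Fin 3 ↦ fr i.succ) σ U O :=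
    hD.isAdapted hO ht Fin.succ hU (fun y hy ↦ hy.1.2) (fun y hy ↦ hσd y hy.1.1)
      fun y hy ↦ hcoord y hy.2
  have hG : ∀ y ∈ U, ∀ i j, components (pullback (𝓡∂ 4) (𝓡 3) ι q) e y i j = A (σ y) i j :=
    fun y hy ↦ hcomp y hy.1.1 (hσ.mfderiv_single y hy)
  set V := O ∩ range fun x : X ↦ (Φ x : M)
  have hpV : ι p ∈ closure V := by
    have := mem_closure_range_diffeomorph Φ (ι p)
    exact hO.inter_closure ⟨hp, this⟩
  have hw : ∀ y : H, (adaptedFields t fr q N).w (ι y) = 0 := by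
    intro y
    change t 0 (ι y) = 0
    rw [ht0]
    exact h.Ω_eq_zero y
  have hh : ∀ y ∈ U, (adaptedFields t fr q N).h (σ y)
      = (components (pullback (𝓡∂ 4) (𝓡 3) ι q) e y)⁻¹ := by
    intro y hy
    rw [show components (pullback (𝓡∂ 4) (𝓡 3) ι q) e y = A (σ y) from Matrix.ext (hG y hy)]
    rfl
  have key := fun i j ↦ hS.tangentialRicci_eq (i := i) (j := j) hO hp inter_subset_left hpV (hw p)
    (by
      rintro _ ⟨hm, x, rfl⟩
      exact (h.isInterior_jet hD ht0 hdet hm).N_zero)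
    (by
      rintro _ ⟨hm, x, rfl⟩
      exact h.limitRicci_eq_zero hO hD ht ht0 hdet hm i j)
  refine ⟨?_, fun i j ↦ ?_⟩
  · rw [← (key 0 0).1]
    simp only [digamma, adaptedFields, ht0]
  · refine (FrameFields.ricci_boundary hS hO hσ hG (fun y _ ↦ hw _) hh hzU i j).trans
      ((key i j).2.trans ?_)
    -- The limit yields the component of q with transposed indices.
    have hsymm : components (pullback (𝓡∂ 4) (𝓡 3) ι q) e z i j
        = components (pullback (𝓡∂ 4) (𝓡 3) ι q) e z j i := (h.q_lorentzian p).symm _ _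
    rw [hsymm, hG z hzU j i]
    rfl

end SpatialInfinity

end

open SpatialInfinity in
theorem mainTheorem3 {X M H : Type*}
    [TopologicalSpace X] [ChartedSpace (EuclideanSpace ℝ (Fin 4)) X] [IsManifold (𝓡 4) ∞ X]
    [TopologicalSpace M] [ChartedSpace (EuclideanHalfSpace 4) M] [IsManifold (𝓡∂ 4) ∞ M]
    [TopologicalSpace H] [ChartedSpace (EuclideanSpace ℝ (Fin 3)) H] [IsManifold (𝓡 3) ∞ H]
    (g : BilinField (𝓡 4) X) (Φ : X ≃ₘ^∞⟮𝓡 4, 𝓡∂ 4⟯ (interiorOpens M)) (ι : H → M)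
    (Ω : M → ℝ) (q : BilinField (𝓡∂ 4) M) (N : ∀ p : M, TangentSpace (𝓡∂ 4) p)
    (h : IsAMSI g Φ ι Ω q N) :
    (∃ c : ℝ, ∀ p : H, digamma Ω N (ι p) = c) ∧
      RicciEq (pullback (𝓡∂ 4) (𝓡 3) ι q) (fun p : H ↦ 2 * digamma Ω N (ι p)) ∧
      IsEinstein (pullback (𝓡∂ 4) (𝓡 3) ι q) := by
  -- Each point is covered by its preferred chart, so F = −1 on all of ℋ and the Einstein constant
  -- is −2.
  have hF : ∀ p : H, digamma Ω N (ι p) = -1 := by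
    intro p
    have h1 := (h.toIsAsymptote.ricci_boundary (IsManifold.chart_mem_maximalAtlas p)
      (mem_chart_target _ p)).1
    rwa [(chartAt (EuclideanSpace ℝ (Fin 3)) p).left_inv (mem_chart_source _ p)] at h1
  have hR : RicciEq (pullback (𝓡∂ 4) (𝓡 3) ι q) (fun _ ↦ -2) := fun e he z hz i j ↦
    (h.toIsAsymptote.ricci_boundary he hz).2 i j
  refine ⟨⟨-1, hF⟩, fun e he z hz i j ↦ ?_, -2, hR⟩
  refine (hR e he z hz i j).trans ?_
  simp only [hF]
  norm_num
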